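/- Let $p\ge 3$ be a prime. For $k\ge 0$ let row $k$ be the list of coefficients, in order of increasing powers of $x$, of $(1+x)^k$ reduced modulo $p$. For $n\ge 0$ let $a(n)$ be the number of strings of $n$ digits modulo $p$ that occur as $n$ consecutive entries of some row (so $a(0)=1$). Put $$c_1=\frac{(p-1)(p^3+4p^2+3p-4)}{2(p^2+2p+5)},\qquad c_2=\frac{(p-1)(p^5+5p^4-8p^3-15p^2+39p-18)}{2(7p^3-8p^2-9p+18)}.$$ Then $$\liminf_{n\to\infty}\frac{a(n)}{n^2}=c_1,\qquad \limsup_{n\to\infty}\frac{a(n)}{n^2}=c_2 .$$ Consequently $c_1$ and $c_2$ are the sharp constants in the quadratic bounds for $a(n)$: for every $\delta>0$ one has $(c_1-\delta)n^2\le a(n)\le (c_2+\delta)n^2$ for all sufficiently large $n$; if $C n^2\le a(n)$ for all sufficiently large $n$, then $C\le c_1$; and if $a(n)\le C n^2$ for all sufficiently large $n$, then $C\ge c_2$. -/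

import Mathlib

open Filter Polynomial

/-- Row `k` of the automaton of `f` modulo `p`: the polynomial `f ^ k` with its coefficients
reduced modulo `p`. -/
noncomputable def automatonRow (p : ℕ) (f : ℤ[X]) (k : ℕ) : (ZMod p)[X] :=
  (f ^ k).map (Int.castRingHom (ZMod p))

/-- An `m`-block `b` (a string of `m` digits modulo `p`) is accessible for `f` if it occurs as a
string of `m` consecutive entries in the list of coefficients (of `x ^ 0, x ^ 1, …` up to the
degree) of some row. -/
def IsAccessibleBlock (p : ℕ) (f : ℤ[X]) (m : ℕ) (b : Fin m → ZMod p) : Prop :=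
  ∃ k i : ℕ, i + m ≤ (automatonRow p f k).natDegree + 1 ∧
    ∀ j : Fin m, b j = (automatonRow p f k).coeff (i + j)

/-- The number of accessible `m`-blocks of `f` modulo `p`. -/
noncomputable def accessibleCount (p : ℕ) (f : ℤ[X]) (m : ℕ) : ℕ :=
  {b : Fin m → ZMod p | IsAccessibleBlock p f m b}.ncard

/-!
Write `a n` for the number of accessible `n`-blocks of `1 + X` modulo the odd prime `p`.

By Lucas' theorem, a window of length `n` in row `p * q + r`, starting at a position congruent to
`t` modulo `p`, is obtained from a window of row `q` by replacing each entry `c` with the digits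
`c * r.choose s`. So the accessible words of length `n` are the union of `p ^ 2` pieces indexed by
`(r, t)`, and each piece is a copy of the set of accessible words of length `coreLength p n r t`,
about `n / p` (`mem_accessibleWords_iff_exists_piece`, `ncard_piece`). A word `u` in the piece of
`(r, t)` satisfies `(t + i + 1) * u (i + 1) = (r - t - i) * u i` modulo `p`
(`recurrence_of_mem_piece`). Subtracting two such recurrences gives one with constant coefficients,
so a word in two pieces is geometric, and for `n ≥ 3` it is `0`, `c 0 ⋯ 0`, `0 ⋯ 0 c` or
`c, -c, c, …`. Counting these with multiplicity gives the exact identity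
`sum_accessibleCount_coreLength`.

The overcount does not depend on `n`, so it cancels in the increments `s n = a (n + 1) - a n`, for
which `s (p * m + d) = (p - d) * s m + d * s (m + 1)`: the increments at scale `p` interpolate those
at scale `1` linearly. Together with the values `a 0, …, a 3` this makes `s` linear on `[q, 2 * q]`,
`[2 * q, 3 * q]` and `[3 * q, p * q]` for every power `q` of `p` (`countIncrement_formula`), and `a`
an explicit quadratic polynomial in `n` and `q` on each of them
(`accessibleCount_arcs_of_power`, `accessibleCount_power`).

Up to `O(n)`, therefore, `a n / n ^ 2` is a quadratic polynomial in `q / n` on each of the three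
intervals. It is convex on the first, with its minimum, the lower constant, in the interior; concave
on the second, with its maximum, the upper constant, in the interior; and monotone on the third
(`firstForm_eq`, `secondForm_eq`, `thirdForm_monotone`). Rounding the two extremal points for
`q = p ^ k` to integers shows that both constants are approached.
-/

/-! ### Accessible blocks as words -/

section Words

variable (p : ℕ) [hp : Fact p.Prime]

/-- The accessible blocks of length `n` of `1 + X`, extended by zero to functions on `ℕ`, so that
words of different lengths live in one type. Entries beyond the degree of the row are allowed:
by `accessibleCount_eq_ncard` this gives no new words. -/
def accessibleWords (n : ℕ) : Set (ℕ → ZMod p) :=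
  {b | ∃ k i : ℕ, ∀ j, b j = if j < n then ((k.choose (i + j) : ℕ) : ZMod p) else 0}

/-- Lucas' theorem for the splitting of the base `p` digits at position `N`. -/
lemma choose_prime_pow_mul_add (N A B u v : ℕ) (hB : B < p ^ N) (hv : v < p ^ N) :
    (((p ^ N * A + B).choose (p ^ N * u + v) : ℕ) : ZMod p) =
      (A.choose u : ZMod p) * (B.choose v : ZMod p) := by
  have lucas : ∀ a b : ℕ, ((a.choose b : ℕ) : ZMod p) =
      ((a % p).choose (b % p) : ZMod p) * ((a / p).choose (b / p) : ZMod p) := by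
    intro a b
    have := (ZMod.natCast_eq_natCast_iff _ _ _).2
      (Choose.choose_modEq_choose_mod_mul_choose_div_nat (n := a) (k := b) (p := p))
    exact_mod_cast this
  have hp0 : 0 < p := hp.out.pos
  induction N generalizing B v with
  | zero =>
    obtain rfl : B = 0 := by simpa using hB
    obtain rfl : v = 0 := by simpa using hv
    simp
  | succ N ih =>
    have e : ∀ a b : ℕ, (p ^ (N + 1) * a + b) % p = b % p ∧
        (p ^ (N + 1) * a + b) / p = p ^ N * a + b / p := by
      intro a b
      rw [pow_succ', mul_assoc]
      exact ⟨Nat.mul_add_mod _ _ _, Nat.mul_add_div hp0 _ _⟩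
    have hb : ∀ b, b < p ^ (N + 1) → b / p < p ^ N := fun b h =>
      Nat.div_lt_of_lt_mul (by rwa [← pow_succ'])
    rw [lucas, (e A B).1, (e A B).2, (e u v).1, (e u v).2, ih _ _ (hb B hB) (hb v hv),
      lucas B v]
    ring

lemma exists_lt_prime_pow (a b : ℕ) : ∃ N, a < p ^ N ∧ b < p ^ N := by
  refine ⟨a + b, ?_, ?_⟩
  · exact lt_of_le_of_lt (Nat.le_add_right a b) (Nat.lt_pow_self hp.out.one_lt)
  · exact lt_of_le_of_lt (Nat.le_add_left b a) (Nat.lt_pow_self hp.out.one_lt)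

lemma accessibleWords_eq_image (n : ℕ) :
    accessibleWords p n = (fun (b : Fin n → ZMod p) (j : ℕ) => if h : j < n then b ⟨j, h⟩ else 0) ''
      {b | IsAccessibleBlock p (1 + X) n b} := by
  have row : ∀ k, automatonRow p (1 + X) k = (1 + X) ^ k := by
    intro k; simp [automatonRow]
  have coeff : ∀ k i, (automatonRow p (1 + X) k).coeff i = ((k.choose i : ℕ) : ZMod p) := by
    intro k i; rw [row, coeff_one_add_X_pow]
  have deg : ∀ k, (automatonRow p (1 + X) k).natDegree = k := by
    intro k
    rw [row, add_comm]
    simpa using natDegree_pow_X_add_C k (1 : ZMod p)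
  ext b
  constructor
  · rintro ⟨k, i, h⟩
    refine ⟨fun j => b j, ?_, ?_⟩
    · -- adding a large power of `p` to the row index moves the end of the row out of sight
      obtain ⟨N, hk, hi⟩ := exists_lt_prime_pow p k (i + n)
      refine ⟨p ^ N * 1 + k, i, by rw [deg]; omega, fun j => ?_⟩
      have := choose_prime_pow_mul_add p N 1 k 0 (i + j) hk (by omega)
      rw [coeff]
      change b j = _
      rw [h j, if_pos j.2]
      simpa using this.symm
    · funext j
      by_cases hj : j < n
      · simp [hj]
      · simp [hj, h j]
  · rintro ⟨b, ⟨k, i, -, h⟩, rfl⟩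
    refine ⟨k, i, fun j => ?_⟩
    by_cases hj : j < n
    · have := h ⟨j, hj⟩
      rw [coeff] at this
      simpa [hj] using this
    · simp [hj]

lemma finite_accessibleWords (n : ℕ) : (accessibleWords p n).Finite := by
  rw [accessibleWords_eq_image]
  exact (Set.toFinite _).image _

lemma accessibleCount_eq_ncard (n : ℕ) :
    accessibleCount p (1 + X) n = (accessibleWords p n).ncard := by
  rw [accessibleWords_eq_image, Set.ncard_image_of_injective]
  · rfl
  · intro b c h
    funext j
    simpa using congrFun h j

/-- Accessible words are closed under scaling, and each occurs away from the left end of a row. -/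
lemma exists_pos_smul_mem_accessibleWords {n : ℕ} {b : ℕ → ZMod p} (hb : b ∈ accessibleWords p n)
    (c : ZMod p) : ∃ k i : ℕ, 0 < i ∧
      ∀ j, c * b j = if j < n then ((k.choose (i + j) : ℕ) : ZMod p) else 0 := by
  obtain ⟨k, i, h⟩ := hb
  obtain ⟨N, hk, hi⟩ := exists_lt_prime_pow p k (i + n)
  -- row `k + c * p ^ N` contains, from position `p ^ N` on, `c` times row `k`
  refine ⟨p ^ N * c.val + k, p ^ N * 1 + i, by have := hp.out.pos; positivity, fun j => ?_⟩
  rw [h j]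
  split_ifs with hj
  · rw [add_assoc, choose_prime_pow_mul_add p N c.val k 1 (i + j) hk (by omega)]
    simp
  · simp

lemma smul_mem_accessibleWords {n : ℕ} {b : ℕ → ZMod p} (hb : b ∈ accessibleWords p n)
    (c : ZMod p) : (fun j => c * b j) ∈ accessibleWords p n := by
  obtain ⟨k, i, -, h⟩ := exists_pos_smul_mem_accessibleWords p hb c
  exact ⟨k, i, h⟩

lemma zero_mem_accessibleWords (n : ℕ) : (0 : ℕ → ZMod p) ∈ accessibleWords p n :=
  ⟨0, 1, fun j => by simp [Nat.choose_eq_zero_of_lt (show 0 < 1 + j by omega)]⟩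

/-- The word `c 0 0 ⋯ 0`. -/
def headWord (c : ZMod p) : ℕ → ZMod p := fun j => if j = 0 then c else 0

/-- The word `0 ⋯ 0 0 c` of length `n`. -/
def lastWord (n : ℕ) (c : ZMod p) : ℕ → ZMod p := fun j => if j + 1 = n then c else 0

/-- The word `c, -c, c, -c, …` of length `n`. -/
def alternatingWord (n : ℕ) (c : ZMod p) : ℕ → ZMod p := fun j => if j < n then c * (-1) ^ j else 0

lemma headWord_mem {n : ℕ} (hn : 0 < n) (c : ZMod p) : headWord p c ∈ accessibleWords p n := by
  have : headWord p 1 ∈ accessibleWords p n := by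
    refine ⟨0, 0, fun j => ?_⟩
    rcases Nat.eq_zero_or_pos j with rfl | hj
    · simp [headWord, hn]
    · simp [headWord, hj.ne', Nat.choose_eq_zero_of_lt hj]
  convert smul_mem_accessibleWords p this c using 2 with j
  simp [headWord]

lemma lastWord_mem (n : ℕ) (c : ZMod p) : lastWord p n c ∈ accessibleWords p n := by
  have : lastWord p n 1 ∈ accessibleWords p n := by
    obtain ⟨N, -, hN⟩ := exists_lt_prime_pow p 0 n
    refine ⟨p ^ N, p ^ N + 1 - n, fun j => ?_⟩
    by_cases hj : j + 1 = n
    · have : p ^ N + 1 - n + j = p ^ N := by omega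
      simp [lastWord, hj, this, show j < n by omega]
    · simp only [lastWord, hj, if_false]
      split_ifs with hjn
      · exact ((ZMod.natCast_eq_zero_iff _ _).2
          (hp.out.dvd_choose_pow (by omega) (by omega))).symm
      · rfl
  convert smul_mem_accessibleWords p this c using 2 with j
  simp [lastWord]

lemma choose_prime_pow_sub_one (N j : ℕ) (hj : j < p ^ N) :
    (((p ^ N - 1).choose j : ℕ) : ZMod p) = (-1) ^ j := by
  induction j with
  | zero => simp
  | succ j ih =>
    have h1 : (p ^ N).choose (j + 1) = (p ^ N - 1).choose j + (p ^ N - 1).choose (j + 1) := by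
      conv_lhs => rw [show p ^ N = (p ^ N - 1) + 1 by omega]
      exact Nat.choose_succ_succ _ _
    have h2 : (((p ^ N).choose (j + 1) : ℕ) : ZMod p) = 0 :=
      (ZMod.natCast_eq_zero_iff _ _).2 (hp.out.dvd_choose_pow (by omega) (by omega))
    rw [h1, Nat.cast_add, ih (by omega)] at h2
    rw [pow_succ]
    linear_combination h2

lemma alternatingWord_mem (n : ℕ) (c : ZMod p) : alternatingWord p n c ∈ accessibleWords p n := by
  have : alternatingWord p n 1 ∈ accessibleWords p n := by
    obtain ⟨N, -, hN⟩ := exists_lt_prime_pow p 0 n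
    refine ⟨p ^ N - 1, 0, fun j => ?_⟩
    simp only [alternatingWord]
    split_ifs with hj
    · rw [zero_add, choose_prime_pow_sub_one p N j (by omega), one_mul]
    · rfl
  convert smul_mem_accessibleWords p this c using 2 with j
  simp [alternatingWord]

lemma accessibleCount_eq_pow_of_forall_mem {n : ℕ}
    (h : ∀ u : ℕ → ZMod p, (∀ j, n ≤ j → u j = 0) → u ∈ accessibleWords p n) :
    accessibleCount p (1 + X) n = p ^ n := by
  have huniv : {b : Fin n → ZMod p | IsAccessibleBlock p (1 + X) n b} = Set.univ := by
    refine Set.eq_univ_of_forall fun b => ?_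
    have hb := h (fun j => if h : j < n then b ⟨j, h⟩ else 0) fun j hj => by
      simp [not_lt.2 hj]
    rw [accessibleWords_eq_image] at hb
    obtain ⟨b', hb', e⟩ := hb
    have : b' = b := by
      funext j
      simpa using congrFun e j
    exact this ▸ hb'
  rw [accessibleCount, huniv, Set.ncard_univ, Nat.card_eq_fintype_card]
  simp

lemma accessibleCount_zero : accessibleCount p (1 + X) 0 = 1 := by
  have := accessibleCount_eq_pow_of_forall_mem p (n := 0) fun u hu => by
    have : u = 0 := funext fun j => hu j (Nat.zero_le _)
    rw [this]
    exact zero_mem_accessibleWords p 0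
  simpa using this

lemma accessibleCount_one : accessibleCount p (1 + X) 1 = p := by
  have := accessibleCount_eq_pow_of_forall_mem p (n := 1) fun u hu => by
    have : u = headWord p (u 0) := by
      funext j
      rcases Nat.eq_zero_or_pos j with rfl | hj
      · simp [headWord]
      · simp [headWord, hj.ne', hu j hj]
    rw [this]
    exact headWord_mem p one_pos _
  simpa using this

lemma accessibleCount_two : accessibleCount p (1 + X) 2 = p ^ 2 := by
  refine accessibleCount_eq_pow_of_forall_mem p fun u hu => ?_
  by_cases h0 : u 0 = 0
  · have : u = lastWord p 2 (u 1) := by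
      funext j
      rcases j with _ | _ | j
      · simp [lastWord, h0]
      · simp [lastWord]
      · simp [lastWord, hu (j + 1 + 1) (by omega)]
    rw [this]
    exact lastWord_mem p 2 _
  · -- row `y` begins with `1, y`
    have hrow : (fun j => if j < 2 then (((u 1 / u 0).val.choose (0 + j) : ℕ) : ZMod p) else 0) ∈
      accessibleWords p 2 := ⟨_, 0, fun j => rfl⟩
    convert smul_mem_accessibleWords p hrow (u 0) using 1
    funext j
    rcases j with _ | _ | j
    · simp
    · simp [mul_div_cancel₀ _ h0]
    · simp [hu (j + 1 + 1) (by omega)]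

end Words

/-! ### Decomposition of the accessible words by residues -/

section Expansion

variable (p : ℕ)

/-- `1` if the digit of row `q` that produces the first entry of a window starting at residue `t`
in row `p * q + r` is invisible in that window, `0` otherwise. -/
def hiddenDigits (r t : ℕ) : ℕ := if r < t then 1 else 0

/-- The number of entries of row `q` that are visible in a window of length `n ≥ 1` starting at a
position congruent to `t` in row `p * q + r`. -/
def coreLength (n r t : ℕ) : ℕ := (t + n - 1) / p + 1 - hiddenDigits r t

lemma index_lt_coreLength {n r t j : ℕ} (hj : j < n)
    (hv : hiddenDigits r t ≤ (t + j) / p) :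
    (t + j) / p - hiddenDigits r t < coreLength p n r t := by
  have h : (t + j) / p ≤ (t + n - 1) / p := Nat.div_le_div_right (by omega)
  unfold coreLength
  omega

/-- A position before the first visible digit carries a zero binomial coefficient. -/
lemma choose_eq_zero_of_hidden {r t j : ℕ} (hv : (t + j) / p < hiddenDigits r t) :
    r.choose ((t + j) % p) = 0 := by
  unfold hiddenDigits at hv
  split_ifs at hv with h
  · have h0 : (t + j) / p = 0 := Nat.lt_one_iff.1 hv
    have := Nat.div_add_mod (t + j) p
    rw [h0, mul_zero, zero_add] at this
    rw [this]
    exact Nat.choose_eq_zero_of_lt (by omega)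
  · exact absurd hv (Nat.not_lt_zero _)

variable [hp : Fact p.Prime]

/-- The window of length `n`, starting at residue `t`, of the word obtained from `w` by replacing
every entry `c` by the digits `c * r.choose s`, `s < p`. The word `w` begins with the first visible
digit. -/
def expandWord (n r t : ℕ) (w : ℕ → ZMod p) : ℕ → ZMod p := fun j =>
  if j < n then ((r.choose ((t + j) % p) : ℕ) : ZMod p) * w ((t + j) / p - hiddenDigits r t) else 0

/-- The accessible words of length `n` that occur in a row congruent to `r` at a position
congruent to `t` modulo `p`. -/
def piece (n r t : ℕ) : Set (ℕ → ZMod p) :=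
  expandWord p n r t '' accessibleWords p (coreLength p n r t)

lemma choose_cast_ne_zero {r s : ℕ} (hr : r < p) (hs : s ≤ r) :
    ((r.choose s : ℕ) : ZMod p) ≠ 0 := by
  rw [Ne, ZMod.natCast_eq_zero_iff]
  intro h
  have : p ∣ r.factorial := by
    rw [← Nat.choose_mul_factorial_mul_factorial hs]
    exact (h.mul_right _).mul_right _
  exact absurd ((hp.out.dvd_factorial).1 this) (by omega)

lemma choose_mul_add (q r u v : ℕ) (hr : r < p) :
    (((p * q + r).choose (p * u + v) : ℕ) : ZMod p) =
      (r.choose (v % p) : ZMod p) * (q.choose (u + v / p) : ZMod p) := by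
  have h := choose_prime_pow_mul_add p 1 q r (u + v / p) (v % p) (by simpa using hr)
    (by simpa using Nat.mod_lt v hp.out.pos)
  have e : p * u + v = p ^ 1 * (u + v / p) + v % p := by
    have := Nat.div_add_mod v p
    rw [pow_one, mul_add]; omega
  rw [e, mul_comm (r.choose _ : ZMod p), ← h, pow_one]

/-- The visible digits are visible: each has a position in the window carrying a nonzero
binomial coefficient. -/
lemma exists_visible_position {n r t : ℕ} (hn : 0 < n) (ht : t < p) {j : ℕ}
    (hj : j < coreLength p n r t) :
    ∃ i < n, (t + i) / p - hiddenDigits r t = j ∧ (t + i) % p ≤ r := by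
  have hp0 : 0 < p := hp.out.pos
  have start : ∀ l, 0 < l → l ≤ (t + n - 1) / p →
      t + (p * l - t) = p * l ∧ p * l - t < n := by
    intro l hl hln
    have h1 : p * l ≤ t + n - 1 := (Nat.mul_comm p l) ▸ (Nat.le_div_iff_mul_le hp0).1 hln
    have h2 : p * 1 ≤ p * l := Nat.mul_le_mul_left p hl
    omega
  unfold coreLength hiddenDigits at *
  split_ifs at hj ⊢ with h
  · obtain ⟨e, hlt⟩ := start (j + 1) (by omega) (by omega)
    refine ⟨_, hlt, ?_, ?_⟩ <;> rw [e] <;> simp [hp0]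
  · rcases Nat.eq_zero_or_pos j with rfl | hj0
    · exact ⟨0, hn, by simp [Nat.div_eq_of_lt ht], by simpa [Nat.mod_eq_of_lt ht] using h⟩
    · obtain ⟨e, hlt⟩ := start j hj0 (by omega)
      refine ⟨_, hlt, ?_, ?_⟩ <;> rw [e] <;> simp [hp0]

lemma mem_accessibleWords_iff_exists_piece {n : ℕ} (u : ℕ → ZMod p) :
    u ∈ accessibleWords p n ↔ ∃ r < p, ∃ t < p, u ∈ piece p n r t := by
  have hp0 : 0 < p := hp.out.pos
  constructor
  · rintro ⟨k, i, h⟩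
    refine ⟨k % p, Nat.mod_lt _ hp0, i % p, Nat.mod_lt _ hp0, ?_⟩
    refine ⟨fun j => if j < coreLength p n (k % p) (i % p) then
      (((k / p).choose (i / p + hiddenDigits (k % p) (i % p) + j) : ℕ) : ZMod p) else 0,
      ⟨k / p, i / p + hiddenDigits (k % p) (i % p), fun j => rfl⟩, ?_⟩
    funext j
    rw [h j, expandWord]
    split_ifs with hj h1
    · have key := choose_mul_add p (k / p) (k % p) (i / p) (i % p + j) (Nat.mod_lt _ hp0)
      rw [Nat.div_add_mod, ← add_assoc, Nat.div_add_mod] at key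
      rw [key]
      by_cases hv : hiddenDigits (k % p) (i % p) ≤ (i % p + j) / p
      · rw [add_assoc (i / p), Nat.add_sub_cancel' hv]
      · rw [choose_eq_zero_of_hidden p (lt_of_not_ge hv)]
        simp
    · have key := choose_mul_add p (k / p) (k % p) (i / p) (i % p + j) (Nat.mod_lt _ hp0)
      rw [Nat.div_add_mod, ← add_assoc, Nat.div_add_mod] at key
      have hv : ¬ hiddenDigits (k % p) (i % p) ≤ (i % p + j) / p :=
        fun hv => h1 (index_lt_coreLength p hj hv)
      rw [key, choose_eq_zero_of_hidden p (lt_of_not_ge hv)]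
      simp
    · rfl
  · rintro ⟨r, hr, t, ht, w, hw, rfl⟩
    obtain ⟨q, i, hi, h⟩ := exists_pos_smul_mem_accessibleWords p hw 1
    have hle : hiddenDigits r t ≤ 1 := by unfold hiddenDigits; split_ifs <;> simp
    refine ⟨p * q + r, p * (i - hiddenDigits r t) + t, fun j => ?_⟩
    rw [expandWord]
    split_ifs with hj
    · rw [add_assoc, choose_mul_add p q r _ _ hr]
      by_cases hv : hiddenDigits r t ≤ (t + j) / p
      · have := h ((t + j) / p - hiddenDigits r t)
        rw [one_mul, if_pos (index_lt_coreLength p hj hv)] at this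
        rw [this, ← Nat.sub_add_comm (by omega), ← Nat.add_sub_assoc hv]
      · simp [choose_eq_zero_of_hidden p (lt_of_not_ge hv)]
    · rfl

lemma eq_zero_of_length_le {m : ℕ} {w : ℕ → ZMod p} (hw : w ∈ accessibleWords p m) {j : ℕ}
    (hj : m ≤ j) : w j = 0 := by
  obtain ⟨k, i, h⟩ := hw
  rw [h j, if_neg (by omega)]

lemma expandWord_injOn {n r t : ℕ} (hn : 0 < n) (hr : r < p) (ht : t < p) :
    Set.InjOn (expandWord p n r t) (accessibleWords p (coreLength p n r t)) := by
  intro w hw w' hw' h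
  funext j
  by_cases hj : j < coreLength p n r t
  · obtain ⟨i, hi, hij, hir⟩ := exists_visible_position p hn ht hj
    have := congrFun h i
    simp only [expandWord, if_pos hi, hij] at this
    exact mul_left_cancel₀ (choose_cast_ne_zero p hr hir) this
  · rw [eq_zero_of_length_le p hw (not_lt.1 hj), eq_zero_of_length_le p hw' (not_lt.1 hj)]

lemma ncard_piece {n r t : ℕ} (hn : 0 < n) (hr : r < p) (ht : t < p) :
    (piece p n r t).ncard = accessibleCount p (1 + X) (coreLength p n r t) := by
  rw [piece, (expandWord_injOn p hn hr ht).ncard_image, accessibleCount_eq_ncard]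

/-- The identity `(s + 1) * r.choose (s + 1) = (r - s) * r.choose s`, read modulo `p`, survives
expansion, as entries of different digits meet only where a coefficient vanishes. -/
lemma recurrence_of_mem_piece {n r t : ℕ} (hr : r < p) {u : ℕ → ZMod p} (hu : u ∈ piece p n r t)
    {i : ℕ} (hi : i + 1 < n) :
    ((t : ZMod p) + i + 1) * u (i + 1) = ((r : ZMod p) - t - i) * u i := by
  have hp0 : 0 < p := hp.out.pos
  obtain ⟨w, -, rfl⟩ := hu
  simp only [expandWord, if_pos hi, if_pos (show i < n by omega)]
  have hx : ((t : ZMod p) + i) = (((t + i) % p : ℕ) : ZMod p) := by simp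
  have hlt := Nat.mod_lt (t + i) hp0
  set s := (t + i) % p with hs
  rw [show (r : ZMod p) - t - i = r - (t + i) by ring, hx]
  -- at the last position of a digit both sides vanish; elsewhere both entries belong to one digit
  by_cases hsp : s + 1 = p
  · have h1 : ((s : ZMod p) + 1) = 0 := by
      have : ((s + 1 : ℕ) : ZMod p) = 0 := by rw [hsp]; simp
      simpa using this
    rw [h1, zero_mul]
    by_cases hrs : r = s
    · simp [hrs]
    · rw [Nat.choose_eq_zero_of_lt (show r < s by omega)]; simp
  · have hd := Nat.div_add_mod (t + i) p
    have e : t + (i + 1) = (s + 1) + p * ((t + i) / p) := by omega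
    have e1 : (t + (i + 1)) % p = s + 1 := by
      rw [e, Nat.add_mul_mod_self_left, Nat.mod_eq_of_lt (by omega)]
    have e2 : (t + (i + 1)) / p = (t + i) / p := by
      rw [e, Nat.add_mul_div_left _ _ hp0, Nat.div_eq_of_lt (by omega), zero_add]
    rw [e1, e2]
    have key : ((r.choose (s + 1) : ℕ) : ZMod p) * (s + 1) =
        (r.choose s : ℕ) * ((r : ZMod p) - s) := by
      rcases le_or_gt s r with h | h
      · rw [← Nat.cast_sub h]
        exact_mod_cast congrArg (Nat.cast (R := ZMod p)) (Nat.choose_succ_right_eq r s)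
      · rw [Nat.choose_eq_zero_of_lt h, Nat.choose_eq_zero_of_lt (by omega)]; simp
    linear_combination w ((t + i) / p - hiddenDigits r t) * key

end Expansion

/-! ### Multiplicities in the decomposition -/

section Multiplicity

variable (p : ℕ) [hp : Fact p.Prime]

lemma apply_eq_zero_of_mem_piece {n r t : ℕ} {u : ℕ → ZMod p} (hu : u ∈ piece p n r t) {j : ℕ}
    (hj : n ≤ j) : u j = 0 := by
  obtain ⟨w, -, rfl⟩ := hu
  simp [expandWord, not_lt.2 hj]

lemma eq_of_natCast_eq {a b : ℕ} (ha : a < p) (hb : b < p) (h : (a : ZMod p) = b) : a = b := by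
  rw [ZMod.natCast_eq_natCast_iff', Nat.mod_eq_of_lt ha, Nat.mod_eq_of_lt hb] at h
  exact h

/-- A word lying in two pieces satisfies two linear recurrences; their difference has constant
coefficients, so the word is geometric, and the only admissible ratio besides `0` and `∞` is
`-1`. -/
lemma exceptional_of_mem_two_pieces {n r t r' t' : ℕ} (hn : 3 ≤ n) (hr : r < p) (ht : t < p)
    (hr' : r' < p) (ht' : t' < p) {u : ℕ → ZMod p} (hu : u ∈ piece p n r t)
    (hu' : u ∈ piece p n r' t') (hne : (r, t) ≠ (r', t')) :
    u = 0 ∨ ∃ c ≠ 0, u = headWord p c ∨ u = lastWord p n c ∨ u = alternatingWord p n c := by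
  by_contra! hcon
  obtain ⟨h0, hc⟩ := hcon
  have rec1 := fun i hi => recurrence_of_mem_piece p hr hu (i := i) hi
  have rec2 := fun i hi => recurrence_of_mem_piece p hr' hu' (i := i) hi
  have hdiff : ∀ i, i + 1 < n →
      ((t : ZMod p) - t') * u (i + 1) = ((r : ZMod p) - r' - (t - t')) * u i := by
    intro i hi
    linear_combination rec1 i hi - rec2 i hi
  by_cases htt : (t : ZMod p) - t' = 0
  · -- ratio `∞`: only the last entry can be nonzero
    have hrr : (r : ZMod p) - r' ≠ 0 := by
      intro h
      refine hne ?_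
      rw [eq_of_natCast_eq p hr hr' (sub_eq_zero.1 h),
        eq_of_natCast_eq p ht ht' (sub_eq_zero.1 htt)]
    have hu0 : ∀ i, i + 1 < n → u i = 0 := by
      intro i hi
      have := hdiff i hi
      rw [htt, zero_mul, sub_zero] at this
      exact (mul_eq_zero.1 this.symm).resolve_left hrr
    have hlast : u = lastWord p n (u (n - 1)) := by
      funext j
      unfold lastWord
      split_ifs with hj
      · rw [← hj, Nat.add_sub_cancel]
      · rcases lt_or_ge j n with h | h
        · exact hu0 j (by omega)
        · exact apply_eq_zero_of_mem_piece p hu h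
    by_cases hz : u (n - 1) = 0
    · refine h0 (funext fun j => ?_)
      rw [hlast, hz]; simp [lastWord]
    · exact (hc _ hz).2.1 hlast
  · -- ratio `l`: the recurrences at `i = 0` and `i = 1` force `l = 0` or `l = -1`
    set l : ZMod p := ((r : ZMod p) - r' - (t - t')) / (t - t') with hl
    have hgeo : ∀ i, i + 1 < n → u (i + 1) = l * u i := by
      intro i hi
      rw [hl, div_mul_eq_mul_div, eq_div_iff htt, mul_comm]
      exact hdiff i hi
    have hpow : ∀ j, u j = if j < n then u 0 * l ^ j else 0 := by
      intro j
      split_ifs with hj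
      · induction j with
        | zero => simp
        | succ j ih => rw [hgeo j hj, ih (by omega)]; ring
      · exact apply_eq_zero_of_mem_piece p hu (not_lt.1 hj)
    by_cases hz : u 0 = 0
    · refine h0 (funext fun j => ?_)
      rw [hpow j, hz]; simp
    by_cases hl0 : l = 0
    · refine (hc _ hz).1 (funext fun j => ?_)
      rw [hpow j, hl0]
      rcases Nat.eq_zero_or_pos j with rfl | hj
      · simp [headWord, show 0 < n by omega]
      · simp [headWord, hj.ne']
    · have e0 := rec1 0 (by omega)
      have e1 := rec1 1 (by omega)
      rw [hgeo 1 (by omega), hgeo 0 (by omega)] at e1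
      rw [hgeo 0 (by omega)] at e0
      have f0 : ((t : ZMod p) + 1) * l = r - t := by
        refine mul_right_cancel₀ hz ?_
        push_cast at e0
        linear_combination e0
      have f1 : ((t : ZMod p) + 2) * l = r - t - 1 := by
        refine mul_right_cancel₀ (mul_ne_zero hl0 hz) ?_
        push_cast at e1
        linear_combination e1
      have hl1 : l = -1 := by linear_combination f1 - f0
      refine (hc _ hz).2.2 (funext fun j => ?_)
      rw [hpow j, hl1]
      rfl

lemma zero_mem_piece (n r t : ℕ) : (0 : ℕ → ZMod p) ∈ piece p n r t :=
  ⟨0, zero_mem_accessibleWords p _, funext fun j => by simp [expandWord]⟩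

lemma headWord_mem_piece_iff {n r t : ℕ} (hn : 2 ≤ n) (hr : r < p) (ht : t < p) {c : ZMod p}
    (hc : c ≠ 0) : headWord p c ∈ piece p n r t ↔ r = t := by
  constructor
  · intro h
    have := recurrence_of_mem_piece p hr h (i := 0) (by omega)
    simp only [headWord] at this
    refine eq_of_natCast_eq p hr ht (sub_eq_zero.1 ?_)
    simpa [hc] using this
  · rintro rfl
    refine ⟨headWord p c, headWord_mem p (by simp [coreLength, hiddenDigits]) c, ?_⟩
    funext j
    rcases Nat.eq_zero_or_pos j with rfl | hj
    · simp [expandWord, headWord, hiddenDigits, Nat.mod_eq_of_lt hr, Nat.div_eq_of_lt hr,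
        show 0 < n by omega]
    · simp only [expandWord, headWord, hiddenDigits, lt_irrefl, if_false, Nat.sub_zero, hj.ne']
      split_ifs with h1 h2
      · have := Nat.div_add_mod (r + j) p
        rw [h2, mul_zero, zero_add] at this
        rw [this, Nat.choose_eq_zero_of_lt (by omega)]
        simp
      · simp
      · rfl

lemma lastWord_mem_piece_iff {n r t : ℕ} (hn : 2 ≤ n) (hr : r < p) {c : ZMod p}
    (hc : c ≠ 0) : lastWord p n c ∈ piece p n r t ↔ p ∣ t + n - 1 := by
  have hp0 : 0 < p := hp.out.pos
  constructor
  · intro h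
    have := recurrence_of_mem_piece p hr h (i := n - 2) (by omega)
    have e : (t : ZMod p) + (n - 2 : ℕ) + 1 = ((t + n - 1 : ℕ) : ZMod p) := by
      rw [show t + n - 1 = t + (n - 2) + 1 by omega]; push_cast; rfl
    rw [e] at this
    rw [← ZMod.natCast_eq_zero_iff]
    simpa [lastWord, hc, show n - 2 + 1 + 1 = n by omega, show n - 2 + 1 ≠ n by omega] using this
  · rintro ⟨m, hm⟩
    have hm0 : 0 < m := Nat.pos_of_ne_zero fun h => by rw [h] at hm; omega
    have hd : (t + n - 1) / p = m := by rw [hm, Nat.mul_div_cancel_left _ hp0]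
    have hle : hiddenDigits r t ≤ 1 := by unfold hiddenDigits; split_ifs <;> simp
    refine ⟨lastWord p _ c, lastWord_mem p _ c, ?_⟩
    funext j
    simp only [expandWord, lastWord, coreLength, hd]
    by_cases hj : j + 1 = n
    · have e : t + j = p * m := by omega
      rw [if_pos (show j < n by omega), e, Nat.mul_mod_right, Nat.mul_div_cancel_left _ hp0,
        if_pos (by omega), if_pos hj]
      simp
    · rw [if_neg hj]
      split_ifs with h1 h2
      · have hlt : (t + j) / p < m := Nat.div_lt_of_lt_mul (by omega)
        rw [choose_eq_zero_of_hidden p (r := r) (by omega)]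
        simp
      · simp
      · rfl

lemma alternatingWord_mem_piece_iff {n r t : ℕ} (hp3 : 3 ≤ p) (hn : 2 ≤ n) (hr : r < p)
    (ht : t < p) {c : ZMod p} (hc : c ≠ 0) :
    alternatingWord p n c ∈ piece p n r t ↔ r = p - 1 := by
  have hp0 : 0 < p := hp.out.pos
  constructor
  · intro h
    have := recurrence_of_mem_piece p hr h (i := 0) (by omega)
    simp only [alternatingWord, if_pos (show 0 + 1 < n by omega),
      if_pos (show 0 < n by omega)] at this
    have h1 : c * ((r + 1 : ℕ) : ZMod p) = 0 := by
      push_cast at this ⊢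
      linear_combination -this
    have h2 := (ZMod.natCast_eq_zero_iff _ _).1 ((mul_eq_zero.1 h1).resolve_left hc)
    have := Nat.le_of_dvd (by omega) h2
    omega
  · rintro rfl
    have hh : hiddenDigits (p - 1) t = 0 := by
      unfold hiddenDigits; rw [if_neg (by omega)]
    -- as `p` is odd, expanding an alternating word in a row `r = p - 1` continues the alternation
    refine ⟨alternatingWord p _ (c * (-1) ^ t), alternatingWord_mem p _ _, ?_⟩
    funext j
    simp only [expandWord]
    by_cases hj : j < n
    · have hlt := index_lt_coreLength p (r := p - 1) (t := t) hj (by rw [hh]; exact Nat.zero_le _)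
      rw [hh, Nat.sub_zero] at hlt
      simp only [alternatingWord, if_pos hj, hh, Nat.sub_zero, if_pos hlt]
      have hodd : Odd p := hp.out.odd_of_ne_two (by omega)
      have hs := choose_prime_pow_sub_one p 1 ((t + j) % p) (by simpa using Nat.mod_lt _ hp0)
      rw [pow_one] at hs
      rw [hs]
      have h1 : ((-1 : ZMod p)) ^ (t + j) = (-1) ^ ((t + j) / p) * (-1) ^ ((t + j) % p) := by
        conv_lhs => rw [← Nat.div_add_mod (t + j) p, pow_add, pow_mul, hodd.neg_one_pow]
      have h2 : ((-1 : ZMod p)) ^ t * (-1) ^ t = 1 := by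
        rw [← mul_pow]; simp
      calc _ = c * (-1) ^ t * ((-1) ^ ((t + j) / p) * (-1) ^ ((t + j) % p)) := by ring
        _ = c * ((-1) ^ t * (-1) ^ t) * (-1) ^ j := by rw [← h1, pow_add]; ring
        _ = _ := by rw [h2, mul_one]
    · simp [alternatingWord, hj]

open Classical in
/-- The number of pieces containing a given word. -/
noncomputable def pieceMultiplicity (n : ℕ) (u : ℕ → ZMod p) : ℕ :=
  ((Finset.range p ×ˢ Finset.range p).filter fun x => u ∈ piece p n x.1 x.2).card

lemma sum_accessibleCount_coreLength_eq_sum_multiplicity {n : ℕ} (hn : 0 < n) :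
    ∑ t ∈ Finset.range p, ∑ r ∈ Finset.range p,
        accessibleCount p (1 + X) (coreLength p n r t) =
      ∑ u ∈ (finite_accessibleWords p n).toFinset, pieceMultiplicity p n u := by
  classical
  have hcount := Finset.sum_card_bipartiteAbove_eq_sum_card_bipartiteBelow
    (s := (finite_accessibleWords p n).toFinset) (t := Finset.range p ×ˢ Finset.range p)
    (fun u x => u ∈ piece p n x.1 x.2)
  rw [Finset.sum_comm, ← Finset.sum_product']
  refine Eq.trans (Finset.sum_congr rfl ?_) hcount.symm
  rintro ⟨r, t⟩ hx
  obtain ⟨hr, ht⟩ := Finset.mem_product.1 hx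
  rw [Finset.mem_range] at hr ht
  rw [← ncard_piece p hn hr ht, ← Set.ncard_coe_finset]
  congr 1
  ext u
  simp only [Finset.coe_bipartiteBelow, Set.mem_ofPred_eq, Set.Finite.mem_toFinset]
  exact ⟨fun h => ⟨(mem_accessibleWords_iff_exists_piece p u).2 ⟨r, hr, t, ht, h⟩, h⟩, fun h => h.2⟩

lemma pieceMultiplicity_eq_one {n : ℕ} (hn : 3 ≤ n) {u : ℕ → ZMod p}
    (hu : u ∈ accessibleWords p n) (h0 : u ≠ 0)
    (h : ∀ c ≠ 0, u ≠ headWord p c ∧ u ≠ lastWord p n c ∧ u ≠ alternatingWord p n c) :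
    pieceMultiplicity p n u = 1 := by
  obtain ⟨r, hr, t, ht, hrt⟩ := (mem_accessibleWords_iff_exists_piece p u).1 hu
  rw [pieceMultiplicity, Finset.card_eq_one]
  refine ⟨(r, t), Finset.eq_singleton_iff_unique_mem.2 ⟨by simp [hr, ht, hrt], ?_⟩⟩
  rintro ⟨r', t'⟩ hx
  simp only [Finset.mem_filter, Finset.mem_product, Finset.mem_range] at hx
  by_contra hne
  rcases exceptional_of_mem_two_pieces p hn hx.1.1 hx.1.2 hr ht hx.2 hrt hne with
    h1 | ⟨c, hc, h1 | h1 | h1⟩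
  · exact h0 h1
  · exact (h c hc).1 h1
  · exact (h c hc).2.1 h1
  · exact (h c hc).2.2 h1

lemma pieceMultiplicity_zero (n : ℕ) : pieceMultiplicity p n 0 = p ^ 2 := by
  simp [pieceMultiplicity, zero_mem_piece, sq]

lemma pieceMultiplicity_headWord {n : ℕ} (hn : 2 ≤ n) {c : ZMod p} (hc : c ≠ 0) :
    pieceMultiplicity p n (headWord p c) = p := by
  classical
  have : ((Finset.range p ×ˢ Finset.range p).filter fun x => headWord p c ∈ piece p n x.1 x.2) =
      (Finset.range p).image fun r => (r, r) := by
    ext ⟨r, t⟩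
    simp only [Finset.mem_filter, Finset.mem_product, Finset.mem_range, Finset.mem_image,
      Prod.mk.injEq]
    constructor
    · rintro ⟨⟨hr, ht⟩, h⟩
      exact ⟨r, hr, rfl, (headWord_mem_piece_iff p hn hr ht hc).1 h⟩
    · rintro ⟨r, hr, rfl, rfl⟩
      exact ⟨⟨hr, hr⟩, (headWord_mem_piece_iff p hn hr hr hc).2 rfl⟩
  rw [pieceMultiplicity, this]
  rw [Finset.card_image_of_injective _ fun a b h => (Prod.mk.inj h).1, Finset.card_range]

lemma pieceMultiplicity_lastWord {n : ℕ} (hn : 2 ≤ n) {c : ZMod p} (hc : c ≠ 0) :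
    pieceMultiplicity p n (lastWord p n c) = p := by
  have hp0 : 0 < p := hp.out.pos
  have hdvd : ∀ t, p ∣ t + n - 1 ↔ (t : ZMod p) = 1 - n := by
    intro t
    rw [← ZMod.natCast_eq_zero_iff, show t + n - 1 = t + (n - 1) by omega,
      Nat.cast_add, Nat.cast_sub (by omega), Nat.cast_one]
    constructor <;> intro h <;> linear_combination h
  classical
  have : ((Finset.range p ×ˢ Finset.range p).filter fun x => lastWord p n c ∈ piece p n x.1 x.2) =
      (Finset.range p).image fun r => (r, ((1 : ZMod p) - n).val) := by
    ext ⟨r, t⟩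
    simp only [Finset.mem_filter, Finset.mem_product, Finset.mem_range, Finset.mem_image,
      Prod.mk.injEq]
    constructor
    · rintro ⟨⟨hr, ht⟩, h⟩
      refine ⟨r, hr, rfl, ?_⟩
      rw [← (hdvd t).1 ((lastWord_mem_piece_iff p hn hr hc).1 h), ZMod.val_cast_of_lt ht]
    · rintro ⟨r, hr, rfl, rfl⟩
      exact ⟨⟨hr, ZMod.val_lt _⟩, (lastWord_mem_piece_iff p hn hr hc).2 ((hdvd _).2 (by simp))⟩
  rw [pieceMultiplicity, this]
  rw [Finset.card_image_of_injective _ fun a b h => (Prod.mk.inj h).1, Finset.card_range]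

lemma pieceMultiplicity_alternatingWord {n : ℕ} (hp3 : 3 ≤ p) (hn : 2 ≤ n) {c : ZMod p}
    (hc : c ≠ 0) : pieceMultiplicity p n (alternatingWord p n c) = p := by
  classical
  have : ((Finset.range p ×ˢ Finset.range p).filter
      fun x => alternatingWord p n c ∈ piece p n x.1 x.2) =
      (Finset.range p).image fun t => (p - 1, t) := by
    ext ⟨r, t⟩
    simp only [Finset.mem_filter, Finset.mem_product, Finset.mem_range, Finset.mem_image,
      Prod.mk.injEq]
    constructor
    · rintro ⟨⟨hr, ht⟩, h⟩
      exact ⟨t, ht, ((alternatingWord_mem_piece_iff p hp3 hn hr ht hc).1 h).symm, rfl⟩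
    · rintro ⟨t, ht, rfl, rfl⟩
      exact ⟨⟨by omega, ht⟩,
        (alternatingWord_mem_piece_iff p hp3 hn (by omega) ht hc).2 rfl⟩
  rw [pieceMultiplicity, this]
  rw [Finset.card_image_of_injective _ fun a b h => (Prod.mk.inj h).2, Finset.card_range]

/-- The decomposition into pieces overcounts the zero word `p ^ 2 - 1` times and each of the
`3 * (p - 1)` other exceptional words `p - 1` times. -/
lemma sum_accessibleCount_coreLength (hp3 : 3 ≤ p) {n : ℕ} (hn : 3 ≤ n) :
    ∑ t ∈ Finset.range p, ∑ r ∈ Finset.range p,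
        accessibleCount p (1 + X) (coreLength p n r t) =
      accessibleCount p (1 + X) n + (p ^ 2 - 1) + 3 * ((p - 1) * (p - 1)) := by
  classical
  have hp0 : 0 < p := hp.out.pos
  rw [sum_accessibleCount_coreLength_eq_sum_multiplicity p (by omega), accessibleCount_eq_ncard,
    Set.ncard_eq_toFinset_card _ (finite_accessibleWords p n)]
  set W := (finite_accessibleWords p n).toFinset with hW
  have memW : ∀ u, u ∈ W ↔ u ∈ accessibleWords p n := fun u => by simp [hW]
  set U : Finset (ZMod p) := Finset.univ.erase 0 with hU
  have memU : ∀ c, c ∈ U ↔ c ≠ 0 := fun c => by simp [hU]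
  have cardU : U.card = p - 1 := by
    rw [hU, Finset.card_erase_of_mem (Finset.mem_univ _), Finset.card_univ, ZMod.card]
  have head0 : ∀ c, headWord p c 0 = c := fun c => by simp [headWord]
  have head1 : ∀ c, headWord p c 1 = 0 := fun c => by simp [headWord]
  have last0 : ∀ c, lastWord p n c 0 = 0 := fun c => by simp [lastWord]; omega
  have lastn : ∀ c, lastWord p n c (n - 1) = c := fun c => by
    simp [lastWord, show n - 1 + 1 = n by omega]
  have alt0 : ∀ c, alternatingWord p n c 0 = c := fun c => by
    simp [alternatingWord, show 0 < n by omega]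
  have alt1 : ∀ c, alternatingWord p n c 1 = -c := fun c => by
    simp [alternatingWord, show 1 < n by omega]
  have headinj : Function.Injective (headWord p) := fun a b h => by rw [← head0 a, h, head0]
  have lastinj : Function.Injective (lastWord p n) := fun a b h => by rw [← lastn a, h, lastn]
  have altinj : Function.Injective (alternatingWord p n) := fun a b h => by rw [← alt0 a, h, alt0]
  -- the three families of exceptional words
  set H := U.image (headWord p) with hH
  set T := U.image (lastWord p n) with hT
  set A := U.image (alternatingWord p n) with hA
  have dHT : Disjoint H T := by
    rw [Finset.disjoint_left]
    intro u h1 h2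
    obtain ⟨c, hc, rfl⟩ := Finset.mem_image.1 h1
    obtain ⟨d, hd, e⟩ := Finset.mem_image.1 h2
    refine (memU c).1 hc ?_
    rw [← head0 c, ← e, last0]
  have dHTA : Disjoint (H ∪ T) A := by
    rw [Finset.disjoint_left]
    intro u h1 h2
    obtain ⟨c, hc, rfl⟩ := Finset.mem_image.1 h2
    refine (memU c).1 hc ?_
    rcases Finset.mem_union.1 h1 with h | h
    · obtain ⟨d, hd, e⟩ := Finset.mem_image.1 h
      rw [← neg_eq_zero, ← alt1 c, ← e, head1]
    · obtain ⟨d, hd, e⟩ := Finset.mem_image.1 h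
      rw [← alt0 c, ← e, last0]
  have d0 : (0 : ℕ → ZMod p) ∉ H ∪ T ∪ A := by
    intro h
    simp only [Finset.mem_union] at h
    rcases h with (h | h) | h <;> obtain ⟨d, hd, e⟩ := Finset.mem_image.1 h <;>
      refine (memU d).1 hd ?_
    · rw [← head0 d, e]; rfl
    · rw [← lastn d, e]; rfl
    · rw [← alt0 d, e]; rfl
  have multH : ∀ u ∈ H, pieceMultiplicity p n u = p := by
    intro u h
    obtain ⟨c, hc, rfl⟩ := Finset.mem_image.1 h
    exact pieceMultiplicity_headWord p (by omega) ((memU c).1 hc)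
  have multT : ∀ u ∈ T, pieceMultiplicity p n u = p := by
    intro u h
    obtain ⟨c, hc, rfl⟩ := Finset.mem_image.1 h
    exact pieceMultiplicity_lastWord p (by omega) ((memU c).1 hc)
  have multA : ∀ u ∈ A, pieceMultiplicity p n u = p := by
    intro u h
    obtain ⟨c, hc, rfl⟩ := Finset.mem_image.1 h
    exact pieceMultiplicity_alternatingWord p hp3 (by omega) ((memU c).1 hc)
  have hsub : insert 0 (H ∪ T ∪ A) ⊆ W := by
    intro u h
    rw [memW]
    simp only [Finset.mem_insert, Finset.mem_union] at h
    rcases h with rfl | (h | h) | h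
    · exact zero_mem_accessibleWords p n
    all_goals obtain ⟨c, hc, rfl⟩ := Finset.mem_image.1 h
    · exact headWord_mem p (by omega) c
    · exact lastWord_mem p n c
    · exact alternatingWord_mem p n c
  have hone : ∀ u ∈ W, u ∉ insert 0 (H ∪ T ∪ A) → pieceMultiplicity p n u = 1 := by
    intro u hu h
    simp only [Finset.mem_insert, Finset.mem_union, not_or] at h
    refine pieceMultiplicity_eq_one p hn ((memW u).1 hu) h.1 fun c hc => ⟨?_, ?_, ?_⟩
    · rintro rfl; exact h.2.1.1 (Finset.mem_image_of_mem _ ((memU c).2 hc))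
    · rintro rfl; exact h.2.1.2 (Finset.mem_image_of_mem _ ((memU c).2 hc))
    · rintro rfl; exact h.2.2 (Finset.mem_image_of_mem _ ((memU c).2 hc))
  -- the excess `pieceMultiplicity - 1` is supported on the exceptional words
  have hsplit : ∑ u ∈ W, pieceMultiplicity p n u =
      W.card + ∑ u ∈ W, (pieceMultiplicity p n u - 1) := by
    rw [Finset.card_eq_sum_ones, ← Finset.sum_add_distrib]
    refine Finset.sum_congr rfl fun u hu => ?_
    have : 1 ≤ pieceMultiplicity p n u := by
      by_cases h : u ∈ insert 0 (H ∪ T ∪ A)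
      · simp only [Finset.mem_insert, Finset.mem_union] at h
        rcases h with rfl | (h | h) | h
        · rw [pieceMultiplicity_zero]; exact Nat.pow_pos hp0
        · rw [multH u h]; exact hp0
        · rw [multT u h]; exact hp0
        · rw [multA u h]; exact hp0
      · rw [hone u hu h]
    omega
  have hconst : ∀ S : Finset (ℕ → ZMod p), (∀ u ∈ S, pieceMultiplicity p n u = p) →
      S.card = p - 1 → ∑ u ∈ S, (pieceMultiplicity p n u - 1) = (p - 1) * (p - 1) := by
    intro S hS hc
    rw [Finset.sum_congr rfl fun u hu => by rw [hS u hu], Finset.sum_const, hc, smul_eq_mul]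
  rw [hsplit, ← Finset.sum_subset hsub fun u hu h => by
    rw [hone u hu h, Nat.sub_self], Finset.sum_insert d0,
    Finset.sum_union dHTA, Finset.sum_union dHT, pieceMultiplicity_zero,
    hconst H multH (by rw [hH, Finset.card_image_of_injective _ headinj, cardU]),
    hconst T multT (by rw [hT, Finset.card_image_of_injective _ lastinj, cardU]),
    hconst A multA (by rw [hA, Finset.card_image_of_injective _ altinj, cardU])]
  ring

end Multiplicity

/-! ### Recursion for the increments -/

section Increments

variable (p : ℕ)

/-- The increment `a (n + 1) - a n` of the number `a n` of accessible `n`-blocks of `1 + X`. -/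
noncomputable def countIncrement (n : ℕ) : ℝ :=
  (accessibleCount p (1 + X) (n + 1) : ℝ) - accessibleCount p (1 + X) n

lemma sum_range_hiddenDigits (f : ℕ → ℝ) {t : ℕ} (ht : t ≤ p) :
    ∑ r ∈ Finset.range p, f (hiddenDigits r t) = t * f 1 + ((p : ℝ) - t) * f 0 := by
  rw [← Finset.sum_range_add_sum_Ico _ ht]
  have h1 : ∀ r ∈ Finset.range t, f (hiddenDigits r t) = f 1 := fun r hr => by
    rw [hiddenDigits, if_pos (Finset.mem_range.1 hr)]
  have h2 : ∀ r ∈ Finset.Ico t p, f (hiddenDigits r t) = f 0 := fun r hr => by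
    rw [hiddenDigits, if_neg (not_lt.2 (Finset.mem_Ico.1 hr).1)]
  rw [Finset.sum_congr rfl h1, Finset.sum_congr rfl h2]
  simp [Nat.cast_sub ht]

variable [hp : Fact p.Prime]

/-- Lengthening the window by one entry reveals a new digit for exactly one starting residue. -/
lemma countIncrement_mul_add_of_pos (hp3 : 3 ≤ p) {m d : ℕ} (hd : 0 < d) (hdp : d ≤ p)
    (hn : 3 ≤ p * m + d) :
    countIncrement p (p * m + d) =
      ((p : ℝ) - d) * countIncrement p m + d * countIncrement p (m + 1) := by
  have hp0 : 0 < p := hp.out.pos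
  have e1 := congrArg (Nat.cast (R := ℝ)) (sum_accessibleCount_coreLength p hp3 hn)
  have e2 := congrArg (Nat.cast (R := ℝ))
    (sum_accessibleCount_coreLength p hp3 (show 3 ≤ p * m + d + 1 by omega))
  rw [Nat.cast_add, Nat.cast_add, Nat.cast_sum] at e1 e2
  have e3 : countIncrement p (p * m + d) = ∑ t ∈ Finset.range p,
      (((∑ r ∈ Finset.range p,
        accessibleCount p (1 + X) (coreLength p (p * m + d + 1) r t) : ℕ) : ℝ) -
      ((∑ r ∈ Finset.range p,
        accessibleCount p (1 + X) (coreLength p (p * m + d) r t) : ℕ) : ℝ)) := by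
    rw [Finset.sum_sub_distrib, e1, e2, countIncrement]
    ring
  -- the entry added to the window opens a new digit precisely when it is at a multiple of `p`
  rw [e3, Finset.sum_eq_single_of_mem (p - d) (Finset.mem_range.2 (by omega))]
  · have h1 : (p - d + (p * m + d + 1) - 1) / p = m + 1 := by
      rw [show p - d + (p * m + d + 1) - 1 = p * (m + 1) by rw [mul_add]; omega]
      exact Nat.mul_div_cancel_left _ hp0
    have h2 : (p - d + (p * m + d) - 1) / p = m := by
      rw [show p - d + (p * m + d) - 1 = p * m + (p - 1) by omega, Nat.mul_add_div hp0,
        Nat.div_eq_of_lt (by omega), add_zero]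
    have h3 : ∀ r, hiddenDigits r (p - d) ≤ 1 := fun r => by
      unfold hiddenDigits; split_ifs <;> simp
    have h4 : ∀ r, (accessibleCount p (1 + X) (coreLength p (p * m + d + 1) r (p - d)) : ℝ) -
        accessibleCount p (1 + X) (coreLength p (p * m + d) r (p - d)) =
        countIncrement p (m + 1 - hiddenDigits r (p - d)) := by
      intro r
      have := h3 r
      rw [coreLength, coreLength, h1, h2, countIncrement,
        show m + 1 + 1 - hiddenDigits r (p - d) = m + 1 - hiddenDigits r (p - d) + 1 by omega]
    rw [Nat.cast_sum, Nat.cast_sum, ← Finset.sum_sub_distrib, Finset.sum_congr rfl fun r _ => h4 r,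
      sum_range_hiddenDigits p (fun h => countIncrement p (m + 1 - h)) (Nat.sub_le p d),
      Nat.cast_sub hdp]
    simp
  · intro t ht hne
    have ht := Finset.mem_range.1 ht
    have hnd : ¬ p ∣ (t + (p * m + d) - 1) + 1 := by
      rw [show (t + (p * m + d) - 1) + 1 = p * m + (t + d) by omega,
        Nat.dvd_add_right (Dvd.intro _ rfl)]
      rintro ⟨l, hl⟩
      have h1 : 0 < l := Nat.pos_of_ne_zero fun h => by rw [h] at hl; omega
      have h2 : l < 2 := by
        by_contra h
        have := Nat.mul_le_mul_left p (not_lt.1 h)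
        omega
      have : l = 1 := by omega
      rw [this] at hl
      omega
    have := Nat.succ_div_of_not_dvd hnd
    have h : ∀ r, coreLength p (p * m + d + 1) r t = coreLength p (p * m + d) r t := by
      intro r
      rw [coreLength, coreLength, ← this]
      congr 3
      omega
    simp [h]

lemma countIncrement_mul (hp3 : 3 ≤ p) {m : ℕ} (hm : 0 < m) :
    countIncrement p (p * m) = p * countIncrement p m := by
  obtain ⟨m, rfl⟩ : ∃ l, m = l + 1 := ⟨m - 1, by omega⟩
  have := countIncrement_mul_add_of_pos p hp3 (m := m) (d := p) (by omega) le_rfl (by omega)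
  rw [mul_add, mul_one, this]
  ring

lemma countIncrement_zero : countIncrement p 0 = p - 1 := by
  simp [countIncrement, accessibleCount_zero, accessibleCount_one]

lemma countIncrement_one : countIncrement p 1 = p * (p - 1) := by
  rw [countIncrement, show 1 + 1 = 2 from rfl, accessibleCount_two, accessibleCount_one]
  push_cast
  ring

/-- The first value of `a` that is not a full power of `p`, read off from the case `n = 3` of
`sum_accessibleCount_coreLength`, whose left side involves only `a 0`, `a 1` and `a 2`. -/
lemma accessibleCount_three (hp3 : 3 ≤ p) :
    (accessibleCount p (1 + X) 3 : ℝ) =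
      (p : ℝ) ^ 3 - p ^ 2 + 3 * p - 2 - (p - 1) * (p - 2) * (p - 3) / 2 := by
  have e := congrArg (Nat.cast (R := ℝ)) (sum_accessibleCount_coreLength p hp3 le_rfl)
  obtain ⟨k, hk⟩ : ∃ k, p = k + 2 := ⟨p - 2, by omega⟩
  have hsum : ∀ t ≤ p, ∀ c, (t + 2) / p = c →
      ((∑ r ∈ Finset.range p, accessibleCount p (1 + X) (coreLength p 3 r t) : ℕ) : ℝ) =
        t * (accessibleCount p (1 + X) c : ℝ) +
          ((p : ℝ) - t) * accessibleCount p (1 + X) (c + 1) := by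
    intro t ht c hc
    have hf := sum_range_hiddenDigits p (fun h => (accessibleCount p (1 + X) (c + 1 - h) : ℝ)) ht
    simp only [Nat.add_sub_cancel, Nat.sub_zero] at hf
    rw [Nat.cast_sum, ← hf]
    refine Finset.sum_congr rfl fun r _ => ?_
    rw [coreLength, show t + 3 - 1 = t + 2 by omega, hc]
  -- the residues `t < p - 2`, for which the window of length `3` meets a single digit
  have hlow : ∑ t ∈ Finset.range k, ((t : ℝ) * 1 + ((p : ℝ) - t) * p) =
      k * (k - 1) / 2 * (1 - p) + k * p ^ 2 := by
    clear hk
    induction k with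
    | zero => simp
    | succ k ih => rw [Finset.sum_range_succ, ih]; push_cast; ring
  have hsplit : ∀ G : ℕ → ℝ, ∑ t ∈ Finset.range p, G t =
      ∑ t ∈ Finset.range k, G t + G k + G (k + 1) := by
    intro G
    rw [hk, Finset.sum_range_succ, Finset.sum_range_succ]
  have hp1 : 1 ≤ p ^ 2 := Nat.one_le_pow _ _ (by omega)
  have hdiv : ∀ t, p ≤ t + 2 → t < p → (t + 2) / p = 1 := fun t h1 h2 =>
    Nat.div_eq_of_lt_le (by omega) (by omega)
  rw [Nat.cast_sum, hsplit, hsum k (by omega) 1 (hdiv k (by omega) (by omega)),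
    hsum (k + 1) (by omega) 1 (hdiv (k + 1) (by omega) (by omega)),
    Finset.sum_congr rfl fun t ht => hsum t (by have := Finset.mem_range.1 ht; omega) 0
      (Nat.div_eq_of_lt (by have := Finset.mem_range.1 ht; omega))] at e
  simp only [accessibleCount_zero, zero_add, accessibleCount_one, Nat.cast_one,
    Nat.reduceAdd, accessibleCount_two] at e
  rw [hlow] at e
  push_cast [Nat.cast_sub hp1, Nat.cast_sub (show 1 ≤ p by omega)] at e
  have hkR : (k : ℝ) = p - 2 := by rw [hk]; push_cast; ring
  rw [hkR] at e
  linear_combination -e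

end Increments

/-! ### Exact piecewise quadratic formula -/

section Exact

variable (p : ℕ) [hp : Fact p.Prime]

/-- Linearity of the increments on an interval is inherited by the interval scaled by `p`. -/
lemma countIncrement_linear_scale (hp3 : 3 ≤ p) {l h : ℕ} (hl : 0 < l) {α β : ℝ}
    (H : ∀ n, l ≤ n → n ≤ h → countIncrement p n = α + β * n) {n : ℕ} (h1 : p * l ≤ n)
    (h2 : n ≤ p * h) : countIncrement p n = p * α + β * n := by
  have hp0 : 0 < p := hp.out.pos
  have hdm := Nat.div_add_mod n p
  have hlt := Nat.mod_lt n hp0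
  have hlm : l ≤ n / p := (Nat.le_div_iff_mul_le hp0).2 (by rwa [mul_comm])
  have hmh : n / p ≤ h := Nat.div_le_of_le_mul h2
  rcases Nat.eq_zero_or_pos (n % p) with h0 | h0
  · have hn : n = p * (n / p) := by omega
    rw [hn, countIncrement_mul p hp3 (by omega), H _ hlm hmh]
    push_cast
    ring
  · have hmh' : n / p + 1 ≤ h := by
      by_contra hc
      have : n / p = h := by omega
      rw [this] at hdm
      omega
    have hm3 : p * 1 ≤ p * (n / p) := Nat.mul_le_mul_left p (by omega)
    have key := countIncrement_mul_add_of_pos p hp3 (m := n / p) h0 hlt.le (by omega)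
    rw [hdm, H _ hlm hmh, H _ (by omega) hmh'] at key
    have hcast : (n : ℝ) = p * (n / p : ℕ) + (n % p : ℕ) := by exact_mod_cast hdm.symm
    rw [key, hcast]
    push_cast
    ring

/-- For `q` a power of `p`, the increments are linear on `[q, 2 * q]`, `[2 * q, 3 * q]` and
`[3 * q, p * q]`. -/
lemma countIncrement_formula (hp3 : 3 ≤ p) (k n : ℕ) :
    (p ^ k ≤ n → n ≤ p ^ k * 2 → countIncrement p n =
      p * (p - 1) * (p : ℝ) ^ k + (p - 1) ^ 2 * (p + 2) / 2 * (n - (p : ℝ) ^ k)) ∧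
    (p ^ k * 2 ≤ n → n ≤ p ^ k * 3 → countIncrement p n =
      (p * (p - 1) + (p - 1) ^ 2 * (p + 2) / 2) * (p : ℝ) ^ k +
        (p - 1) ^ 2 * (4 - p) / 2 * (n - 2 * (p : ℝ) ^ k)) ∧
    (p ^ k * 3 ≤ n → n ≤ p ^ k * p → countIncrement p n =
      (p * (p - 1) + 3 * (p - 1) ^ 2) * (p : ℝ) ^ k + (p - 1) ^ 2 * (n - 3 * (p : ℝ) ^ k)) := by
  induction k generalizing n with
  | zero =>
    have i1 := countIncrement_one p
    have i2 : countIncrement p 2 = p * (p - 1) + (p - 1) ^ 2 * (p + 2) / 2 := by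
      rw [countIncrement, accessibleCount_three p hp3, accessibleCount_two]
      push_cast
      ring
    have i3 : ∀ n, 3 ≤ n → n ≤ p → countIncrement p n = p * (p - 1) + (p - 1) ^ 2 * n := by
      intro n h1 h2
      have key := countIncrement_mul_add_of_pos p hp3 (m := 0) (d := n) (by omega) h2 (by omega)
      rw [mul_zero, zero_add, zero_add, countIncrement_zero, i1] at key
      rw [key]
      ring
    simp only [pow_zero, one_mul, mul_one]
    refine ⟨fun h1 h2 => ?_, fun h1 h2 => ?_, fun h1 h2 => ?_⟩
    · rcases (show n = 1 ∨ n = 2 by omega) with rfl | rfl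
      · rw [i1]; push_cast; ring
      · rw [i2]; push_cast; ring
    · rcases (show n = 2 ∨ n = 3 by omega) with rfl | rfl
      · rw [i2]; push_cast; ring
      · rw [i3 3 le_rfl hp3]; push_cast; ring
    · rw [i3 n h1 h2]; ring
  | succ k ih =>
    have hq : 0 < p ^ k := Nat.pow_pos hp.out.pos
    refine ⟨fun h1 h2 => ?_, fun h1 h2 => ?_, fun h1 h2 => ?_⟩
    · rw [countIncrement_linear_scale p hp3 hq
        (α := (p * (p - 1) - (p - 1) ^ 2 * (p + 2) / 2) * (p : ℝ) ^ k)
        (β := (p - 1) ^ 2 * (p + 2) / 2)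
        (fun n a b => by rw [(ih n).1 a b]; ring) (h := p ^ k * 2)
        (by rwa [← pow_succ']) (by rwa [← mul_assoc, ← pow_succ'])]
      ring
    · rw [countIncrement_linear_scale p hp3 (l := p ^ k * 2) (by omega)
        (α := (p * (p - 1) + (p - 1) ^ 2 * (p + 2) / 2 - (p - 1) ^ 2 * (4 - p)) * (p : ℝ) ^ k)
        (β := (p - 1) ^ 2 * (4 - p) / 2)
        (fun n a b => by rw [(ih n).2.1 a b]; ring) (h := p ^ k * 3)
        (by rwa [← mul_assoc, ← pow_succ']) (by rwa [← mul_assoc, ← pow_succ'])]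
      ring
    · rw [countIncrement_linear_scale p hp3 (l := p ^ k * 3) (by omega)
        (α := (p * (p - 1)) * (p : ℝ) ^ k) (β := (p - 1) ^ 2)
        (fun n a b => by rw [(ih n).2.2 a b]; ring) (h := p ^ k * p)
        (by rwa [← mul_assoc, ← pow_succ']) (by rwa [← mul_assoc, ← pow_succ'])]
      ring

omit hp in
/-- Summation of increments that are linear on `[l, h]`. -/
lemma accessibleCount_of_linear {l h : ℕ} {σ τ : ℝ}
    (H : ∀ n, l ≤ n → n ≤ h → countIncrement p n = σ + τ * (n - l)) {n : ℕ} (hl : l ≤ n)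
    (hn : n ≤ h) : (accessibleCount p (1 + X) n : ℝ) =
      accessibleCount p (1 + X) l + σ * (n - l) + τ * ((n - l) * (n - l - 1)) / 2 := by
  induction n, hl using Nat.le_induction with
  | base => simp
  | succ n hl ih =>
    have h1 := ih (by omega)
    have h2 := H n hl (by omega)
    rw [countIncrement] at h2
    push_cast
    linear_combination h1 + h2

/-- The value of `a q` at a power `q` of `p`. -/
noncomputable def powerValue (p q : ℝ) : ℝ :=
  (p - 1) ^ 2 * (p + 4) / (2 * (p + 1)) * q ^ 2 - p * (p - 1) / 2 * q + (4 * p - 2) / (p + 1)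

/-- The quadratic polynomial in `q` and `n` that gives `a n` on `[q, 2 * q]`, for `q` a power of
`p`. -/
noncomputable def firstArc (p q n : ℝ) : ℝ :=
  powerValue p q + p * (p - 1) * q * (n - q) +
    (p - 1) ^ 2 * (p + 2) / 2 * ((n - q) * (n - q - 1)) / 2

/-- The analogue of `firstArc` on `[2 * q, 3 * q]`, continuing its value at `2 * q`. -/
noncomputable def secondArc (p q n : ℝ) : ℝ :=
  firstArc p q (2 * q) + (p * (p - 1) + (p - 1) ^ 2 * (p + 2) / 2) * q * (n - 2 * q) +
    (p - 1) ^ 2 * (4 - p) / 2 * ((n - 2 * q) * (n - 2 * q - 1)) / 2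

/-- The analogue of `firstArc` on `[3 * q, p * q]`, continuing the value of `secondArc` at
`3 * q`. -/
noncomputable def thirdArc (p q n : ℝ) : ℝ :=
  secondArc p q (3 * q) + (p * (p - 1) + 3 * (p - 1) ^ 2) * q * (n - 3 * q) +
    (p - 1) ^ 2 * ((n - 3 * q) * (n - 3 * q - 1)) / 2

lemma accessibleCount_arcs_of_power (hp3 : 3 ≤ p) (k : ℕ)
    (h0 : (accessibleCount p (1 + X) (p ^ k) : ℝ) = powerValue p ((p : ℝ) ^ k)) (n : ℕ) :
    (p ^ k ≤ n → n ≤ p ^ k * 2 →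
      (accessibleCount p (1 + X) n : ℝ) = firstArc p ((p : ℝ) ^ k) n) ∧
    (p ^ k * 2 ≤ n → n ≤ p ^ k * 3 →
      (accessibleCount p (1 + X) n : ℝ) = secondArc p ((p : ℝ) ^ k) n) ∧
    (p ^ k * 3 ≤ n → n ≤ p ^ k * p →
      (accessibleCount p (1 + X) n : ℝ) = thirdArc p ((p : ℝ) ^ k) n) := by
  have hq : 0 < p ^ k := Nat.pow_pos hp.out.pos
  have c2 : ((p ^ k * 2 : ℕ) : ℝ) = 2 * (p : ℝ) ^ k := by push_cast; ring
  have c3 : ((p ^ k * 3 : ℕ) : ℝ) = 3 * (p : ℝ) ^ k := by push_cast; ring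
  have A1 : ∀ n, p ^ k ≤ n → n ≤ p ^ k * 2 →
      (accessibleCount p (1 + X) n : ℝ) = firstArc p ((p : ℝ) ^ k) n := by
    intro n h1 h2
    rw [accessibleCount_of_linear p (fun n a b => by
      rw [(countIncrement_formula p hp3 k n).1 a b, ← Nat.cast_pow]) h1 h2, h0, firstArc]
    push_cast
    ring
  have A2 : ∀ n, p ^ k * 2 ≤ n → n ≤ p ^ k * 3 →
      (accessibleCount p (1 + X) n : ℝ) = secondArc p ((p : ℝ) ^ k) n := by
    intro n h1 h2
    rw [accessibleCount_of_linear p (fun n a b => by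
      rw [(countIncrement_formula p hp3 k n).2.1 a b, ← c2]) h1 h2,
      A1 (p ^ k * 2) (by omega) le_rfl, secondArc, c2]
  refine ⟨A1 n, A2 n, fun h1 h2 => ?_⟩
  rw [accessibleCount_of_linear p (fun n a b => by
    rw [(countIncrement_formula p hp3 k n).2.2 a b, ← c3]) h1 h2,
    A2 (p ^ k * 3) (by omega) le_rfl, thirdArc, c3]

/-- The right end `p * q` of the third interval is the left end of the first interval for the next
power, so the value at `p ^ k` follows by induction on `k`. -/
lemma accessibleCount_power (hp3 : 3 ≤ p) (k : ℕ) :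
    (accessibleCount p (1 + X) (p ^ k) : ℝ) = powerValue p ((p : ℝ) ^ k) := by
  have hR : (3 : ℝ) ≤ p := by exact_mod_cast hp3
  have h1 : (p : ℝ) + 1 ≠ 0 := by positivity
  induction k with
  | zero =>
    rw [pow_zero, accessibleCount_one, powerValue, pow_zero]
    field_simp
    ring
  | succ k ih =>
    have := (accessibleCount_arcs_of_power p hp3 k ih (p ^ k * p)).2.2
      (Nat.mul_le_mul_left _ hp3) le_rfl
    rw [pow_succ, this, thirdArc, secondArc, firstArc, powerValue, powerValue]
    push_cast
    field_simp
    ring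

end Exact

/-! ### The leading quadratic forms and their extrema -/

section Forms

/-- The leading quadratic form of `firstArc`, divided by `(p - 1) ^ 2`. -/
noncomputable def firstForm (p q n : ℝ) : ℝ :=
  (p + 2) / 4 * n ^ 2 - (p - 2) * (p + 1) / (2 * (p - 1)) * (q * n) +
    (p - 2) * (p ^ 2 + 2 * p + 5) / (4 * (p ^ 2 - 1)) * q ^ 2

/-- The leading quadratic form of `secondArc`, divided by `(p - 1) ^ 2`. -/
noncomputable def secondForm (p q n : ℝ) : ℝ :=
  (4 - p) / 4 * n ^ 2 + (3 * p ^ 2 - 7 * p + 6) / (2 * (p - 1)) * (q * n) -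
    (7 * p ^ 3 - 8 * p ^ 2 - 9 * p + 18) / (4 * (p ^ 2 - 1)) * q ^ 2

/-- The leading quadratic form of `thirdArc`, divided by `(p - 1) ^ 2`. -/
noncomputable def thirdForm (p q n : ℝ) : ℝ :=
  1 / 2 * n ^ 2 + p / (p - 1) * (q * n) + p ^ 2 * (p - 5) / (2 * (p ^ 2 - 1)) * q ^ 2

/-- The lower limit of `a n / n ^ 2`. -/
noncomputable def lowerConstant (p : ℝ) : ℝ :=
  (p - 1) * (p ^ 3 + 4 * p ^ 2 + 3 * p - 4) / (2 * (p ^ 2 + 2 * p + 5))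

/-- The upper limit of `a n / n ^ 2`. -/
noncomputable def upperConstant (p : ℝ) : ℝ :=
  (p - 1) * (p ^ 5 + 5 * p ^ 4 - 8 * p ^ 3 - 15 * p ^ 2 + 39 * p - 18) /
    (2 * (7 * p ^ 3 - 8 * p ^ 2 - 9 * p + 18))

variable {p : ℝ} (hp : 3 ≤ p)
include hp

lemma sub_one_ne_zero_of_three_le : p - 1 ≠ 0 := by intro h; linarith

lemma add_one_ne_zero_of_three_le : p + 1 ≠ 0 := by positivity

lemma cubic_pos : 0 < 7 * p ^ 3 - 8 * p ^ 2 - 9 * p + 18 := by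
  nlinarith [mul_nonneg (sub_nonneg.2 hp) (sq_nonneg p),
    mul_nonneg (sub_nonneg.2 hp) (sub_nonneg.2 hp)]

lemma quadratic_pos : 0 < 3 * p ^ 2 - 7 * p + 6 := by nlinarith

/-- Completing the square in `q`: the minimum of the first form is at
`n / q = (p ^ 2 + 2 * p + 5) / (p + 1) ^ 2`. -/
lemma firstForm_eq (q n : ℝ) : (p - 1) ^ 2 * firstForm p q n = lowerConstant p * n ^ 2 +
    (p - 1) * (p - 2) * (p ^ 2 + 2 * p + 5) / (4 * (p + 1)) *
      (q - (p + 1) ^ 2 / (p ^ 2 + 2 * p + 5) * n) ^ 2 := by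
  have h1 := sub_one_ne_zero_of_three_le hp
  have h2 := add_one_ne_zero_of_three_le hp
  have h3 : p ^ 2 + 2 * p + 5 ≠ 0 := by positivity
  rw [firstForm, lowerConstant, show p ^ 2 - 1 = (p - 1) * (p + 1) by ring]
  field_simp
  ring

/-- Completing the square in `q`: the maximum of the second form is at
`n / q = (7 * p ^ 3 - 8 * p ^ 2 - 9 * p + 18) / ((p + 1) * (3 * p ^ 2 - 7 * p + 6))`. -/
lemma secondForm_eq (q n : ℝ) : (p - 1) ^ 2 * secondForm p q n = upperConstant p * n ^ 2 -
    (p - 1) * (7 * p ^ 3 - 8 * p ^ 2 - 9 * p + 18) / (4 * (p + 1)) *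
      (q - (p + 1) * (3 * p ^ 2 - 7 * p + 6) / (7 * p ^ 3 - 8 * p ^ 2 - 9 * p + 18) * n) ^ 2 := by
  have h1 := sub_one_ne_zero_of_three_le hp
  have h2 := add_one_ne_zero_of_three_le hp
  have h3 := (cubic_pos hp).ne'
  rw [secondForm, upperConstant, show p ^ 2 - 1 = (p - 1) * (p + 1) by ring]
  generalize hC : 7 * p ^ 3 - 8 * p ^ 2 - 9 * p + 18 = C at *
  field_simp
  rw [← hC]
  ring

lemma secondForm_eq_firstForm_sub (q n : ℝ) :
    secondForm p q n = firstForm p q n - (p - 1) / 2 * (n - 2 * q) ^ 2 := by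
  have h1 := sub_one_ne_zero_of_three_le hp
  have h2 := add_one_ne_zero_of_three_le hp
  rw [firstForm, secondForm, show p ^ 2 - 1 = (p - 1) * (p + 1) by ring]
  field_simp
  ring

lemma thirdForm_eq_secondForm_add (q n : ℝ) :
    thirdForm p q n = secondForm p q n + (p - 2) / 4 * (n - 3 * q) ^ 2 := by
  have h1 := sub_one_ne_zero_of_three_le hp
  have h2 := add_one_ne_zero_of_three_le hp
  rw [thirdForm, secondForm, show p ^ 2 - 1 = (p - 1) * (p + 1) by ring]
  field_simp
  ring

/-- Moving `n` from `q` to `p * q` multiplies the form by `p ^ 2`. -/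
lemma thirdForm_end : thirdForm p 1 p = p ^ 2 * firstForm p 1 1 := by
  have h1 := sub_one_ne_zero_of_three_le hp
  have h2 := add_one_ne_zero_of_three_le hp
  rw [thirdForm, firstForm, show p ^ 2 - 1 = (p - 1) * (p + 1) by ring]
  field_simp
  ring

lemma lowerConstant_le_firstForm (q n : ℝ) :
    lowerConstant p * n ^ 2 ≤ (p - 1) ^ 2 * firstForm p q n := by
  rw [firstForm_eq hp]
  have : 0 ≤ (p - 1) * (p - 2) * (p ^ 2 + 2 * p + 5) / (4 * (p + 1)) :=
    div_nonneg (mul_nonneg (mul_nonneg (by linarith) (by linarith)) (by positivity)) (by positivity)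
  linarith [mul_nonneg this (sq_nonneg (q - (p + 1) ^ 2 / (p ^ 2 + 2 * p + 5) * n))]

lemma secondForm_le_upperConstant (q n : ℝ) :
    (p - 1) ^ 2 * secondForm p q n ≤ upperConstant p * n ^ 2 := by
  rw [secondForm_eq hp]
  have : 0 ≤ (p - 1) * (7 * p ^ 3 - 8 * p ^ 2 - 9 * p + 18) / (4 * (p + 1)) :=
    div_nonneg (mul_nonneg (by linarith) (cubic_pos hp).le) (by positivity)
  linarith [mul_nonneg this (sq_nonneg (q - (p + 1) * (3 * p ^ 2 - 7 * p + 6) /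
    (7 * p ^ 3 - 8 * p ^ 2 - 9 * p + 18) * n))]

/-- The third form divided by `n ^ 2` increases with `q / n` up to `q / n = 1 / 3`. -/
lemma thirdForm_monotone {q q' n : ℝ} (hq : 0 ≤ q) (hqq : q ≤ q') (hq' : 3 * q' ≤ n) :
    thirdForm p q n ≤ thirdForm p q' n := by
  have hn : 0 ≤ n := by linarith
  have h1 : 0 < p - 1 := by linarith
  have h2 : 0 < p + 1 := by linarith
  have key : thirdForm p q' n - thirdForm p q n =
      (q' - q) * (p * (2 * (p + 1) * n + p * (p - 5) * (q + q'))) / (2 * ((p - 1) * (p + 1))) := by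
    rw [thirdForm, thirdForm, show p ^ 2 - 1 = (p - 1) * (p + 1) by ring]
    field_simp
    ring
  have hpos : 0 ≤ 2 * (p + 1) * n + p * (p - 5) * (q + q') := by
    have h3 : 0 ≤ p * (p - 3) * (q + q') := by
      have : 0 ≤ p - 3 := by linarith
      have : 0 ≤ q + q' := by linarith
      positivity
    have h4 : 0 ≤ p * (3 / 2 * n - 2 * (q + q') + n / 2) := mul_nonneg (by linarith) (by linarith)
    nlinarith
  have : 0 ≤ thirdForm p q' n - thirdForm p q n := by
    rw [key]
    have : 0 ≤ q' - q := by linarith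
    have : 0 ≤ p := by linarith
    positivity
  linarith

omit hp in
lemma thirdForm_smul (c q n : ℝ) : thirdForm p (c * q) (c * n) = c ^ 2 * thirdForm p q n := by
  unfold thirdForm; ring

/-- By monotonicity the third form is compared with its value at `n = p * q`, which is that of the
first form at `n = q` for the next power of `p`. -/
lemma lowerConstant_le_thirdForm {q n : ℝ} (hq : 3 * q ≤ n) (hn : n ≤ p * q) (h0 : 0 ≤ n) :
    lowerConstant p * n ^ 2 ≤ (p - 1) ^ 2 * thirdForm p q n := by
  have hp0 : p ≠ 0 := by linarith
  have hdiv : n / p ≤ q := (div_le_iff₀' (by linarith)).2 hn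
  have h1 := thirdForm_monotone hp (q := n / p) (by positivity) hdiv hq
  have h2 : thirdForm p (n / p) n = n ^ 2 * firstForm p 1 1 := by
    have := thirdForm_smul (p := p) (n / p) 1 p
    rw [thirdForm_end hp, mul_one, div_mul_cancel₀ _ hp0] at this
    rw [this]
    field_simp
  have h3 := lowerConstant_le_firstForm hp 1 1
  calc lowerConstant p * n ^ 2 ≤ ((p - 1) ^ 2 * firstForm p 1 1) * n ^ 2 := by
        refine mul_le_mul_of_nonneg_right ?_ (sq_nonneg n); linarith
    _ = (p - 1) ^ 2 * thirdForm p (n / p) n := by rw [h2]; ring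
    _ ≤ _ := mul_le_mul_of_nonneg_left h1 (sq_nonneg _)

/-- By monotonicity the third form is compared with its value at `n = 3 * q`, where it agrees with
the second form. -/
lemma thirdForm_le_upperConstant {q n : ℝ} (hq : 3 * q ≤ n) (h0 : 0 ≤ q) :
    (p - 1) ^ 2 * thirdForm p q n ≤ upperConstant p * n ^ 2 := by
  have h1 := thirdForm_monotone hp (q' := n / 3) (n := n) h0 (by linarith) (by linarith)
  have h2 := secondForm_le_upperConstant hp (n / 3) n
  rw [thirdForm_eq_secondForm_add hp (n / 3), show n - 3 * (n / 3) = 0 by ring] at h1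
  refine le_trans (mul_le_mul_of_nonneg_left h1 (sq_nonneg _)) ?_
  linarith

/-- On `[2 * q, 3 * q]` the ratio to `n ^ 2` is concave in `q / n`, so it is bounded below by its
values at the ends. -/
lemma lowerConstant_le_secondForm {q n : ℝ} (hq : 2 * q ≤ n) (hn : n ≤ 3 * q) :
    lowerConstant p * n ^ 2 ≤ (p - 1) ^ 2 * secondForm p q n := by
  have hX : lowerConstant p * 2 ^ 2 ≤ (p - 1) ^ 2 * secondForm p 1 2 := by
    have := lowerConstant_le_firstForm hp 1 2
    rw [secondForm_eq_firstForm_sub hp]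
    linarith
  have hY : lowerConstant p * 3 ^ 2 ≤ (p - 1) ^ 2 * secondForm p 1 3 := by
    have := lowerConstant_le_thirdForm hp (q := 1) (n := 3) (by norm_num) (by linarith)
      (by norm_num)
    rw [thirdForm_eq_secondForm_add hp] at this
    linarith
  have hC : 0 ≤ (p - 1) ^ 2 * ((7 * p ^ 3 - 8 * p ^ 2 - 9 * p + 18) / (4 * (p ^ 2 - 1))) := by
    have := (cubic_pos hp).le
    have : 0 ≤ p ^ 2 - 1 := by nlinarith
    positivity
  have hu : 0 ≤ 3 * q - n := by linarith
  have hv : 0 ≤ n - 2 * q := by linarith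
  unfold secondForm at *
  generalize (7 * p ^ 3 - 8 * p ^ 2 - 9 * p + 18) / (4 * (p ^ 2 - 1)) = C at *
  generalize (3 * p ^ 2 - 7 * p + 6) / (2 * (p - 1)) = B at *
  linarith [mul_nonneg (sub_nonneg.2 hX) (mul_nonneg hu hu),
    mul_nonneg (sub_nonneg.2 hY) (mul_nonneg hv hv),
    mul_nonneg (sub_nonneg.2 hX) (mul_nonneg hu hv),
    mul_nonneg (sub_nonneg.2 hY) (mul_nonneg hu hv),
    mul_nonneg hC (mul_nonneg hu hv)]

/-- On `[q, 2 * q]` the ratio to `n ^ 2` is convex in `q / n`, so it is bounded above by its values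
at the ends. -/
lemma firstForm_le_upperConstant {q n : ℝ} (hq : q ≤ n) (hn : n ≤ 2 * q) :
    (p - 1) ^ 2 * firstForm p q n ≤ upperConstant p * n ^ 2 := by
  have hX : (p - 1) ^ 2 * firstForm p 1 2 ≤ upperConstant p * 2 ^ 2 := by
    have := secondForm_le_upperConstant hp 1 2
    rw [secondForm_eq_firstForm_sub hp] at this
    linarith
  have hY : (p - 1) ^ 2 * firstForm p 1 1 ≤ upperConstant p * 1 ^ 2 := by
    have := thirdForm_le_upperConstant hp (q := 1) (n := p) (by linarith) (by norm_num)
    rw [thirdForm_end hp] at this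
    have hpp : 0 < p ^ 2 := by positivity
    refine le_of_mul_le_mul_left ?_ hpp
    linarith
  have hC : 0 ≤ (p - 1) ^ 2 * ((p - 2) * (p ^ 2 + 2 * p + 5) / (4 * (p ^ 2 - 1))) := by
    have : 0 ≤ p ^ 2 - 1 := by nlinarith
    have : 0 ≤ p - 2 := by linarith
    positivity
  have hu : 0 ≤ 2 * q - n := by linarith
  have hv : 0 ≤ n - q := by linarith
  unfold firstForm at *
  generalize (p - 2) * (p ^ 2 + 2 * p + 5) / (4 * (p ^ 2 - 1)) = C at *
  generalize (p - 2) * (p + 1) / (2 * (p - 1)) = B at *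
  linarith [mul_nonneg (sub_nonneg.2 hX) (mul_nonneg hv hv),
    mul_nonneg (sub_nonneg.2 hY) (mul_nonneg hu hu),
    mul_nonneg (sub_nonneg.2 hX) (mul_nonneg hu hv),
    mul_nonneg (sub_nonneg.2 hY) (mul_nonneg hu hv),
    mul_nonneg hC (mul_nonneg hu hv)]

end Forms

/-! ### Quadratic bounds with linear error -/

section Bounds

/-- A bound, per unit of `n`, for the difference between `a n` and its leading form. -/
noncomputable def errorConstant (p : ℝ) : ℝ := p * (p - 1) / 2 + 4 + 3 * ((p - 1) ^ 2 * (p + 2) / 4)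

lemma abs_arc_sub_form_le {p : ℝ} (hp : 3 ≤ p) {q n : ℝ} (hq : 0 ≤ q) (hn : 1 ≤ n) :
    (q ≤ n → |firstArc p q n - (p - 1) ^ 2 * firstForm p q n| ≤ errorConstant p * n) ∧
    (2 * q ≤ n → |secondArc p q n - (p - 1) ^ 2 * secondForm p q n| ≤ errorConstant p * n) ∧
    (3 * q ≤ n → |thirdArc p q n - (p - 1) ^ 2 * thirdForm p q n| ≤ errorConstant p * n) := by
  have h1 := sub_one_ne_zero_of_three_le hp
  have h2 := add_one_ne_zero_of_three_le hp
  have e1 : firstArc p q n - (p - 1) ^ 2 * firstForm p q n =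
      -(p * (p - 1) / 2 * q) + (4 * p - 2) / (p + 1) - (p - 1) ^ 2 * (p + 2) / 4 * (n - q) := by
    rw [firstArc, firstForm, powerValue, show p ^ 2 - 1 = (p - 1) * (p + 1) by ring]
    field_simp
    ring
  have e2 : secondArc p q n - (p - 1) ^ 2 * secondForm p q n =
      -(p * (p - 1) / 2 * q) + (4 * p - 2) / (p + 1) - (p - 1) ^ 2 * (p + 2) / 4 * q -
        (p - 1) ^ 2 * (4 - p) / 4 * (n - 2 * q) := by
    rw [secondArc, firstArc, secondForm, powerValue, show p ^ 2 - 1 = (p - 1) * (p + 1) by ring]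
    field_simp
    ring
  have e3 : thirdArc p q n - (p - 1) ^ 2 * thirdForm p q n =
      -(p * (p - 1) / 2 * q) + (4 * p - 2) / (p + 1) - (p - 1) ^ 2 * (p + 2) / 4 * q -
        (p - 1) ^ 2 * (4 - p) / 4 * q - (p - 1) ^ 2 / 2 * (n - 3 * q) := by
    rw [thirdArc, secondArc, firstArc, thirdForm, powerValue,
      show p ^ 2 - 1 = (p - 1) * (p + 1) by ring]
    field_simp
    ring
  have g0 : 0 ≤ (4 * p - 2) / (p + 1) := div_nonneg (by linarith) (by linarith)
  have g1 : (4 * p - 2) / (p + 1) ≤ 4 := (div_le_iff₀ (by linarith)).2 (by linarith)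
  have ha : 0 ≤ p * (p - 1) / 2 := by
    have : 0 ≤ p - 1 := by linarith
    positivity
  have hM : 0 ≤ (p - 1) ^ 2 * (p + 2) / 4 := by positivity
  have hs1 : (p - 1) ^ 2 * (4 - p) / 4 ≤ (p - 1) ^ 2 * (p + 2) / 4 := by
    nlinarith [sq_nonneg (p - 1), mul_nonneg (sq_nonneg (p - 1)) (show 0 ≤ p - 1 by linarith)]
  have hs2 : -((p - 1) ^ 2 * (p + 2) / 4) ≤ (p - 1) ^ 2 * (4 - p) / 4 := by
    nlinarith [sq_nonneg (p - 1)]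
  have ht1 : (p - 1) ^ 2 / 2 ≤ (p - 1) ^ 2 * (p + 2) / 4 := by
    nlinarith [mul_nonneg (sq_nonneg (p - 1)) (show 0 ≤ p by linarith)]
  have ht0 : 0 ≤ (p - 1) ^ 2 / 2 := by positivity
  rw [e1, e2, e3]
  unfold errorConstant
  generalize (4 * p - 2) / (p + 1) = g at *
  generalize p * (p - 1) / 2 = a at *
  generalize (p - 1) ^ 2 * (p + 2) / 4 = M at *
  generalize (p - 1) ^ 2 * (4 - p) / 4 = s at *
  generalize (p - 1) ^ 2 / 2 = t at *
  have absorb : ∀ c m x : ℝ, |c| ≤ m → 0 ≤ x → x ≤ n → |c * x| ≤ m * n := by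
    intro c m x hc hx hxn
    rw [abs_mul, abs_of_nonneg hx]
    exact mul_le_mul hc hxn hx ((abs_nonneg c).trans hc)
  have hsM : |s| ≤ M := abs_le.2 ⟨hs2, hs1⟩
  have htM : |t| ≤ M := abs_le.2 ⟨by linarith, ht1⟩
  have haa : |a| ≤ a := (abs_of_nonneg ha).le
  have hMM : |M| ≤ M := (abs_of_nonneg hM).le
  have hMn : 0 ≤ M * n := mul_nonneg hM (by linarith)
  refine ⟨fun h => ?_, fun h => ?_, fun h => ?_⟩
  · have k1 := abs_le.1 (absorb a a q haa hq (by linarith))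
    have k2 := abs_le.1 (absorb M M (n - q) hMM (by linarith) (by linarith))
    exact abs_le.2 ⟨by linarith [k1.1, k1.2, k2.1, k2.2], by linarith [k1.1, k1.2, k2.1, k2.2]⟩
  · have k1 := abs_le.1 (absorb a a q haa hq (by linarith))
    have k2 := abs_le.1 (absorb M M q hMM hq (by linarith))
    have k3 := abs_le.1 (absorb s M (n - 2 * q) hsM (by linarith) (by linarith))
    exact abs_le.2 ⟨by linarith [k1.1, k1.2, k2.1, k2.2, k3.1, k3.2],
      by linarith [k1.1, k1.2, k2.1, k2.2, k3.1, k3.2]⟩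
  · have k1 := abs_le.1 (absorb a a q haa hq (by linarith))
    have k2 := abs_le.1 (absorb M M q hMM hq (by linarith))
    have k3 := abs_le.1 (absorb s M q hsM hq (by linarith))
    have k4 := abs_le.1 (absorb t M (n - 3 * q) htM (by linarith) (by linarith))
    exact abs_le.2 ⟨by linarith [k1.1, k1.2, k2.1, k2.2, k3.1, k3.2, k4.1, k4.2],
      by linarith [k1.1, k1.2, k2.1, k2.2, k3.1, k3.2, k4.1, k4.2]⟩

lemma le_floor_and_floor_le (p : ℕ) {k l : ℕ} {z : ℝ} (h1 : (l : ℝ) ≤ z) (h2 : z ≤ l + 1) :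
    p ^ k * l ≤ ⌊(p : ℝ) ^ k * z⌋₊ ∧ ⌊(p : ℝ) ^ k * z⌋₊ ≤ p ^ k * (l + 1) := by
  have hq : (0 : ℝ) ≤ (p : ℝ) ^ k := by positivity
  constructor
  · refine Nat.le_floor ?_
    push_cast
    exact mul_le_mul_of_nonneg_left h1 hq
  · refine Nat.floor_le_of_le ?_
    push_cast
    exact mul_le_mul_of_nonneg_left h2 hq

variable (p : ℕ) [hp : Fact p.Prime]

lemma accessibleCount_bounds (hp3 : 3 ≤ p) {n : ℕ} (hn : 1 ≤ n) :
    lowerConstant p * (n : ℝ) ^ 2 - errorConstant p * n ≤ accessibleCount p (1 + X) n ∧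
    (accessibleCount p (1 + X) n : ℝ) ≤ upperConstant p * (n : ℝ) ^ 2 + errorConstant p * n := by
  have hR : (3 : ℝ) ≤ p := by exact_mod_cast hp3
  have hnR : (1 : ℝ) ≤ n := by exact_mod_cast hn
  have h1 : p ^ Nat.log p n ≤ n := Nat.pow_log_le_self p (by omega)
  have h2 : n < p ^ Nat.log p n * p := by
    rw [← pow_succ]; exact Nat.lt_pow_succ_log_self hp.out.one_lt n
  generalize Nat.log p n = k at *
  have harc := accessibleCount_arcs_of_power p hp3 k (accessibleCount_power p hp3 k) n
  have hq : (0 : ℝ) ≤ (p : ℝ) ^ k := by positivity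
  have hform := abs_arc_sub_form_le hR hq hnR
  have r1 : (p : ℝ) ^ k ≤ n := by exact_mod_cast h1
  rcases le_total n (p ^ k * 2) with h3 | h3
  · have r3 : (n : ℝ) ≤ 2 * (p : ℝ) ^ k := by rw [mul_comm]; exact_mod_cast h3
    rw [harc.1 h1 h3]
    have e := abs_le.1 (hform.1 r1)
    have l := lowerConstant_le_firstForm hR ((p : ℝ) ^ k) n
    have u := firstForm_le_upperConstant hR r1 r3
    exact ⟨by linarith [e.1], by linarith [e.2]⟩
  have r3 : 2 * (p : ℝ) ^ k ≤ n := by rw [mul_comm]; exact_mod_cast h3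
  rcases le_total n (p ^ k * 3) with h4 | h4
  · have r4 : (n : ℝ) ≤ 3 * (p : ℝ) ^ k := by rw [mul_comm]; exact_mod_cast h4
    rw [harc.2.1 h3 h4]
    have e := abs_le.1 (hform.2.1 r3)
    have l := lowerConstant_le_secondForm hR r3 r4
    have u := secondForm_le_upperConstant hR ((p : ℝ) ^ k) n
    exact ⟨by linarith [e.1], by linarith [e.2]⟩
  · have r4 : 3 * (p : ℝ) ^ k ≤ n := by rw [mul_comm]; exact_mod_cast h4
    have r5 : (n : ℝ) ≤ p * (p : ℝ) ^ k := by rw [mul_comm]; exact_mod_cast h2.le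
    rw [harc.2.2 h4 h2.le]
    have e := abs_le.1 (hform.2.2 r4)
    have l := lowerConstant_le_thirdForm hR r4 r5 (by linarith)
    have u := thirdForm_le_upperConstant hR r4 hq
    exact ⟨by linarith [e.1], by linarith [e.2]⟩

/-- If `n` is `q * z` rounded down, then `q` differs from `n / z` by at most `1`. -/
lemma sq_sub_inv_mul_floor_le_one {q z : ℝ} (hq : 0 ≤ q) (hz : 1 ≤ z) :
    (q - z⁻¹ * (⌊q * z⌋₊ : ℝ)) ^ 2 ≤ 1 := by
  have h1 := Nat.floor_le (mul_nonneg hq (zero_le_one.trans hz))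
  have h2 := Nat.lt_floor_add_one (q * z)
  have hz0 : 0 < z := by linarith
  have e : q - z⁻¹ * (⌊q * z⌋₊ : ℝ) = z⁻¹ * (q * z - ⌊q * z⌋₊) := by
    field_simp
  have hi : z⁻¹ ≤ 1 := inv_le_one_of_one_le₀ hz
  have h0 : 0 ≤ z⁻¹ := by positivity
  rw [e, sq_le_one_iff_abs_le_one, abs_mul, abs_of_nonneg h0, abs_of_nonneg (by linarith)]
  exact mul_le_one₀ hi (by linarith) (by linarith)

/-- The lower constant is approached along `n = ⌊p ^ N * z⌋`, where `z` is the minimum point of the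
first form. -/
lemma exists_near_lowerConstant (hp3 : 3 ≤ p) : ∃ K : ℝ, ∀ N : ℕ, ∃ n ≥ N, 1 ≤ n ∧
    (accessibleCount p (1 + X) n : ℝ) ≤ lowerConstant p * (n : ℝ) ^ 2 + K * n := by
  have hR : (3 : ℝ) ≤ p := by exact_mod_cast hp3
  set z : ℝ := ((p : ℝ) ^ 2 + 2 * p + 5) / (p + 1) ^ 2 with hz
  have hz1 : ((1 : ℕ) : ℝ) ≤ z := by
    rw [hz, le_div_iff₀ (by positivity)]; push_cast; nlinarith
  have hz2 : z ≤ (1 : ℕ) + 1 := by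
    rw [hz, div_le_iff₀ (by positivity)]; push_cast; nlinarith
  set C : ℝ := ((p : ℝ) - 1) * (p - 2) * (p ^ 2 + 2 * p + 5) / (4 * (p + 1)) with hC
  have hC0 : 0 ≤ C :=
    div_nonneg (mul_nonneg (mul_nonneg (by linarith) (by linarith)) (by positivity)) (by positivity)
  refine ⟨errorConstant p + C, fun N => ?_⟩
  obtain ⟨hl, hu⟩ := le_floor_and_floor_le p (k := N) hz1 hz2
  set n := ⌊(p : ℝ) ^ N * z⌋₊ with hn
  have hN : N < p ^ N := Nat.lt_pow_self hp.out.one_lt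
  rw [mul_one] at hl
  refine ⟨n, by omega, by omega, ?_⟩
  have hnR : (1 : ℝ) ≤ n := by exact_mod_cast (show 1 ≤ n by omega)
  rw [(accessibleCount_arcs_of_power p hp3 N (accessibleCount_power p hp3 N) n).1 hl hu]
  have e := abs_le.1 ((abs_arc_sub_form_le hR (q := (p : ℝ) ^ N) (by positivity) hnR).1
    (by exact_mod_cast hl))
  have hsq := sq_sub_inv_mul_floor_le_one (q := (p : ℝ) ^ N) (z := z) (by positivity)
    (by simpa using hz1)
  have hform := firstForm_eq hR ((p : ℝ) ^ N) n
  rw [← hn, hz, inv_div] at hsq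
  rw [← hC] at hform
  have h1 := mul_le_mul_of_nonneg_left hsq hC0
  have h2 := mul_le_mul_of_nonneg_left hnR hC0
  linarith [e.2]

/-- The upper constant is approached along `n = ⌊p ^ N * z⌋`, where `z` is the maximum point of the
second form. -/
lemma exists_near_upperConstant (hp3 : 3 ≤ p) : ∃ K : ℝ, ∀ N : ℕ, ∃ n ≥ N, 1 ≤ n ∧
    upperConstant p * (n : ℝ) ^ 2 - K * n ≤ accessibleCount p (1 + X) n := by
  have hR : (3 : ℝ) ≤ p := by exact_mod_cast hp3
  have hB := quadratic_pos hR
  have hcub := cubic_pos hR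
  set z : ℝ := (7 * (p : ℝ) ^ 3 - 8 * p ^ 2 - 9 * p + 18) / ((p + 1) * (3 * p ^ 2 - 7 * p + 6))
    with hz
  have hp2 : (0 : ℝ) ≤ (p - 3) * p ^ 2 := mul_nonneg (by linarith) (by positivity)
  have hz1 : ((2 : ℕ) : ℝ) ≤ z := by
    rw [hz, le_div_iff₀ (by positivity)]; push_cast; nlinarith
  have hz2 : z ≤ (2 : ℕ) + 1 := by
    rw [hz, div_le_iff₀ (by positivity)]; push_cast; nlinarith
  set C : ℝ := ((p : ℝ) - 1) * (7 * p ^ 3 - 8 * p ^ 2 - 9 * p + 18) / (4 * (p + 1)) with hC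
  have hC0 : 0 ≤ C := div_nonneg (mul_nonneg (by linarith) hcub.le) (by positivity)
  refine ⟨errorConstant p + C, fun N => ?_⟩
  obtain ⟨hl, hu⟩ := le_floor_and_floor_le p (k := N) hz1 hz2
  set n := ⌊(p : ℝ) ^ N * z⌋₊ with hn
  have hN : N < p ^ N := Nat.lt_pow_self hp.out.one_lt
  refine ⟨n, by omega, by omega, ?_⟩
  have hnR : (1 : ℝ) ≤ n := by exact_mod_cast (show 1 ≤ n by omega)
  rw [(accessibleCount_arcs_of_power p hp3 N (accessibleCount_power p hp3 N) n).2.1 hl hu]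
  have e := abs_le.1 ((abs_arc_sub_form_le hR (q := (p : ℝ) ^ N) (by positivity) hnR).2.1
    (by rw [mul_comm]; exact_mod_cast hl))
  have hsq := sq_sub_inv_mul_floor_le_one (q := (p : ℝ) ^ N) (z := z) (by positivity)
    (by refine le_trans ?_ hz1; norm_num)
  have hform := secondForm_eq hR ((p : ℝ) ^ N) n
  rw [← hn, hz, inv_div] at hsq
  rw [← hC] at hform
  have h1 := mul_le_mul_of_nonneg_left hsq hC0
  have h2 := mul_le_mul_of_nonneg_left hnR hC0
  linarith [e.1]

end Bounds

/-! ### Lower and upper limits -/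

section Limits

/-- A sequence with `c₁ n² - O(n) ≤ a n ≤ c₂ n² + O(n)`, both sides being attained up to `O(n)`
for arbitrarily large `n`, has the optimal quadratic growth constants `c₁` and `c₂`. -/
lemma limits_of_quadratic_bounds {a : ℕ → ℝ} {c₁ c₂ K K₁ K₂ : ℝ}
    (hb : ∀ n : ℕ, 1 ≤ n → c₁ * (n : ℝ) ^ 2 - K * n ≤ a n ∧ a n ≤ c₂ * (n : ℝ) ^ 2 + K * n)
    (h₁ : ∀ N : ℕ, ∃ n ≥ N, 1 ≤ n ∧ a n ≤ c₁ * (n : ℝ) ^ 2 + K₁ * n)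
    (h₂ : ∀ N : ℕ, ∃ n ≥ N, 1 ≤ n ∧ c₂ * (n : ℝ) ^ 2 - K₂ * n ≤ a n) :
    liminf (fun n : ℕ => ((a n / (n : ℝ) ^ 2 : ℝ) : EReal)) atTop = (c₁ : EReal) ∧
    limsup (fun n : ℕ => ((a n / (n : ℝ) ^ 2 : ℝ) : EReal)) atTop = (c₂ : EReal) ∧
    (∀ δ : ℝ, 0 < δ → ∀ᶠ n : ℕ in atTop,
      (c₁ - δ) * (n : ℝ) ^ 2 ≤ a n ∧ a n ≤ (c₂ + δ) * (n : ℝ) ^ 2) ∧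
    (∀ C : ℝ, (∀ᶠ n : ℕ in atTop, C * (n : ℝ) ^ 2 ≤ a n) → C ≤ c₁) ∧
    (∀ C : ℝ, (∀ᶠ n : ℕ in atTop, a n ≤ C * (n : ℝ) ^ 2) → c₂ ≤ C) := by
  have lim : ∀ c K : ℝ, Tendsto (fun n : ℕ => c + K / n) atTop (nhds c) := by
    intro c K
    simpa using (tendsto_const_div_atTop_nhds_zero_nat K).const_add c
  have limE : ∀ c K : ℝ,
      Tendsto (fun n : ℕ => ((c + K / n : ℝ) : EReal)) atTop (nhds (c : EReal)) :=
    fun c K => (continuous_coe_real_ereal.tendsto c).comp (lim c K)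
  have le_ratio : ∀ (c K : ℝ) (n : ℕ), 1 ≤ n →
      (c * (n : ℝ) ^ 2 + K * n ≤ a n ↔ c + K / n ≤ a n / (n : ℝ) ^ 2) := by
    intro c K n hn
    have : (0 : ℝ) < n := by exact_mod_cast hn
    rw [le_div_iff₀ (by positivity)]
    have e : (c + K / n) * (n : ℝ) ^ 2 = c * (n : ℝ) ^ 2 + K * n := by field_simp
    rw [e]
  have ratio_le : ∀ (c K : ℝ) (n : ℕ), 1 ≤ n →
      (a n ≤ c * (n : ℝ) ^ 2 + K * n ↔ a n / (n : ℝ) ^ 2 ≤ c + K / n) := by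
    intro c K n hn
    have : (0 : ℝ) < n := by exact_mod_cast hn
    rw [div_le_iff₀ (by positivity)]
    have e : (c + K / n) * (n : ℝ) ^ 2 = c * (n : ℝ) ^ 2 + K * n := by field_simp
    rw [e]
  have hlow : ∀ᶠ n : ℕ in atTop, c₁ + (-K) / n ≤ a n / (n : ℝ) ^ 2 := by
    filter_upwards [eventually_ge_atTop 1] with n hn
    rw [← le_ratio c₁ (-K) n hn]
    linarith [(hb n hn).1]
  have hupp : ∀ᶠ n : ℕ in atTop, a n / (n : ℝ) ^ 2 ≤ c₂ + K / n := by
    filter_upwards [eventually_ge_atTop 1] with n hn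
    exact (ratio_le c₂ K n hn).1 (hb n hn).2
  choose φ hφ hφ1 hφa using h₁
  choose ψ hψ hψ1 hψa using h₂
  have tφ : Tendsto φ atTop atTop := tendsto_atTop_mono hφ tendsto_id
  have tψ : Tendsto ψ atTop atTop := tendsto_atTop_mono hψ tendsto_id
  refine ⟨le_antisymm ?_ ?_, le_antisymm ?_ ?_, fun δ hδ => ?_, fun C hC => ?_, fun C hC => ?_⟩
  · calc _ ≤ liminf (fun n : ℕ => ((a n / (n : ℝ) ^ 2 : ℝ) : EReal)) (map φ atTop) :=
          liminf_le_liminf_of_le tφ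
      _ ≤ liminf (fun n : ℕ => ((c₁ + K₁ / n : ℝ) : EReal)) (map φ atTop) := by
          refine liminf_le_liminf (eventually_map.2 (Eventually.of_forall fun N => ?_))
          exact EReal.coe_le_coe_iff.2 ((ratio_le c₁ K₁ _ (hφ1 N)).1 (hφa N))
      _ = c₁ := ((limE c₁ K₁).mono_left tφ).liminf_eq
  · rw [← (limE c₁ (-K)).liminf_eq]
    exact liminf_le_liminf (hlow.mono fun n h => EReal.coe_le_coe_iff.2 h)
  · rw [← (limE c₂ K).limsup_eq]
    exact limsup_le_limsup (hupp.mono fun n h => EReal.coe_le_coe_iff.2 h)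
  · calc (c₂ : EReal) = limsup (fun n : ℕ => ((c₂ + (-K₂) / n : ℝ) : EReal)) (map ψ atTop) :=
          ((limE c₂ (-K₂)).mono_left tψ).limsup_eq.symm
      _ ≤ limsup (fun n : ℕ => ((a n / (n : ℝ) ^ 2 : ℝ) : EReal)) (map ψ atTop) := by
          refine limsup_le_limsup (eventually_map.2 (Eventually.of_forall fun N => ?_))
          refine EReal.coe_le_coe_iff.2 ((le_ratio c₂ (-K₂) _ (hψ1 N)).1 ?_)
          linarith [hψa N]
      _ ≤ _ := limsup_le_limsup_of_le tψ
  · filter_upwards [(lim c₁ (-K)).eventually (lt_mem_nhds (show c₁ - δ < c₁ by linarith)),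
      (lim c₂ K).eventually (gt_mem_nhds (show c₂ < c₂ + δ by linarith)), hlow, hupp,
      eventually_ge_atTop 1] with n h1 h2 h3 h4 hn
    have hn0 : (0 : ℝ) < (n : ℝ) ^ 2 := by
      have : (0 : ℝ) < n := by exact_mod_cast hn
      positivity
    exact ⟨(le_div_iff₀ hn0).1 (by linarith), (div_le_iff₀ hn0).1 (by linarith)⟩
  · refine ge_of_tendsto ((lim c₁ K₁).comp tφ) ?_
    filter_upwards [tφ.eventually hC] with N hN
    refine le_trans ?_ ((ratio_le c₁ K₁ _ (hφ1 N)).1 (hφa N))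
    have : (0 : ℝ) < φ N := by exact_mod_cast hφ1 N
    exact (le_div_iff₀ (by positivity)).2 hN
  · refine le_of_tendsto ((lim c₂ (-K₂)).comp tψ) ?_
    filter_upwards [tψ.eventually hC] with N hN
    refine le_trans ((le_ratio c₂ (-K₂) _ (hψ1 N)).1 (by linarith [hψa N])) ?_
    have : (0 : ℝ) < ψ N := by exact_mod_cast hψ1 N
    exact (div_le_iff₀ (by positivity)).2 hN

end Limits

theorem mainTheorem4 (p : ℕ) (hp : p.Prime) (hp3 : 3 ≤ p) (c₁ c₂ : ℝ)
    (hc₁ : c₁ = ((p : ℝ) - 1) * ((p : ℝ) ^ 3 + 4 * (p : ℝ) ^ 2 + 3 * (p : ℝ) - 4) /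
      (2 * ((p : ℝ) ^ 2 + 2 * (p : ℝ) + 5)))
    (hc₂ : c₂ = ((p : ℝ) - 1) *
        ((p : ℝ) ^ 5 + 5 * (p : ℝ) ^ 4 - 8 * (p : ℝ) ^ 3 - 15 * (p : ℝ) ^ 2 + 39 * (p : ℝ) - 18) /
      (2 * (7 * (p : ℝ) ^ 3 - 8 * (p : ℝ) ^ 2 - 9 * (p : ℝ) + 18))) :
    -- the lower and upper limits, taken in the extended reals
    liminf (fun n : ℕ =>
        (((accessibleCount p (1 + X) n : ℝ) / (n : ℝ) ^ 2 : ℝ) : EReal)) atTop = (c₁ : EReal) ∧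
    limsup (fun n : ℕ =>
        (((accessibleCount p (1 + X) n : ℝ) / (n : ℝ) ^ 2 : ℝ) : EReal)) atTop = (c₂ : EReal) ∧
    -- up to an arbitrarily small loss, `c₁` and `c₂` bound `a(n) / n ^ 2` for all large `n`
    (∀ δ : ℝ, 0 < δ → ∀ᶠ n : ℕ in atTop,
      (c₁ - δ) * (n : ℝ) ^ 2 ≤ (accessibleCount p (1 + X) n : ℝ) ∧
      (accessibleCount p (1 + X) n : ℝ) ≤ (c₂ + δ) * (n : ℝ) ^ 2) ∧
    -- and no constants do better
    (∀ C : ℝ, (∀ᶠ n : ℕ in atTop, C * (n : ℝ) ^ 2 ≤ (accessibleCount p (1 + X) n : ℝ)) →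
      C ≤ c₁) ∧
    (∀ C : ℝ, (∀ᶠ n : ℕ in atTop, (accessibleCount p (1 + X) n : ℝ) ≤ C * (n : ℝ) ^ 2) →
      c₂ ≤ C) := by
  have : Fact p.Prime := ⟨hp⟩
  obtain ⟨K₁, h₁⟩ := exists_near_lowerConstant p hp3
  obtain ⟨K₂, h₂⟩ := exists_near_upperConstant p hp3
  rw [← lowerConstant] at hc₁
  rw [← upperConstant] at hc₂
  subst hc₁ hc₂
  exact limits_of_quadratic_bounds (fun n hn => accessibleCount_bounds p hp3 hn) h₁ h₂
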